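/- **Conventions.** Let $R$ be a commutative ring with identity (the case $R=\mathbb{Z}$ is the basic one). Let $D$ be an oriented link diagram with $n$ crossings, of which $c_+(D)$ are positive and $c_-(D)$ are negative. For $I\in\{0,1\}^n$ let $h(I)$ be the number of $1$'s in $I$, and let $D(I)$ be the Kauffman state of $D$ with an $A$-resolution at each crossing where $I$ is $0$ and a $B$-resolution at each crossing where $I$ is $1$ (the $A$-resolution joins the two regions swept out by the upper strand when it is rotated counterclockwise). Let $|D(I)|$ be the number of components of $D(I)$. In each state, every crossing leaves a trace, a segment connecting the two arcs of its resolution. The *all-$A$ state graph* $G_A(D)$ is the multigraph whose vertices are the components of the state $D(0,\dots,0)$ and whose edges are the traces of the crossings, each connecting the components at its two ends. The *girth* of a multigraph is the length of a shortest cycle (a loop has length $1$, a pair of parallel edges has length $2$); it is $\infty$ if there is no cycle. Graphs are isomorphic if there are bijections of vertices and of edges that respect incidence. *Odd Khovanov homology.* Let $V(D(I))$ be the free $R$-module on the components of $D(I)$, and $$CKh_{\rm odd}(D)=\bigoplus_{I}\Lambda^*V(D(I)),$$ where $\Lambda^rV(D(I))$ has bigrading $\big(h(I)-c_-(D),\ |D(I)|-2r+h(I)+c_+(D)-2c_-(D)\big)$.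 Choose an orientation of each trace in the all-$A$ state; a trace of an $A$-resolution keeps it, and a trace of a $B$-resolution is oriented by rotating it clockwise by $90^\circ$. An edge $\xi\colon I\to J$ of the cube, which changes one entry from $0$ to $1$, has the map $\Lambda^*V(D(I))\to\Lambda^*V(D(J))$ which is the algebra map induced by the correspondence of components if two components are merged, and $\omega\mapsto (X_{i_1}-X_{i_2})\wedge\eta(\omega)$ if a component is split into $i_1,i_2$, the trace pointing from $i_1$ to $i_2$; here $\eta$ is induced by the correspondence of components, sending the split one to either $i_1$ or $i_2$. Choose a sign assignment, i.e. signs $\epsilon(\xi)=\pm1$ such that all squares of the cube anti-commute once each edge map is multiplied by its sign. The sum of the signed edge maps is a differential of bidegree $(1,0)$, and $Kh_{\rm odd}^{i,j}(D)$ is its homology in bigrading $(i,j)$. **Theorem.** Let $D$ and $D'$ be link diagrams whose all-$A$ state graphs are isomorphic and have girth $g\ge 2$ (possibly $g=\infty$). Then, for any choices of orientations of the traces and of sign assignments for $D$ and for $D'$, $$Kh_{\rm odd}^{i,j}(D)\cong Kh_{\rm odd}^{p,q}(D')$$ as $R$-modules for all $i$ with $-c_-(D)\le i\le -c_-(D)+g-1$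 and all $j$, where $$p+c_-(D')=i+c_-(D),\qquad q-c_+(D')+2c_-(D')=j-c_+(D)+2c_-(D).$$ -/

import Mathlib

noncomputable section

namespace OddKh

/-! ## Multigraphs -/

/-- Two multigraphs are isomorphic if there are bijections between their vertices and between
their edges which respect incidence. -/
def GraphIsomorphic {α β α' β' : Type*} (G : Graph α β) (H : Graph α' β') : Prop :=
  ∃ (f : G.vertexSet ≃ H.vertexSet) (e : G.edgeSet ≃ H.edgeSet),
    ∀ (b : G.edgeSet) (x y : G.vertexSet),
      G.IsLink (b : β) (x : α) (y : α) ↔ H.IsLink (e b : β') (f x : α') (f y : α')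

/-- `G` contains a cycle of length `k`, that is, `k ≥ 1` distinct vertices in cyclic order,
consecutive ones being joined by `k` distinct edges. A loop is a cycle of length `1` and a
pair of parallel edges is a cycle of length `2`. -/
def HasCycleOfLength {α β : Type*} (G : Graph α β) (k : ℕ) : Prop :=
  0 < k ∧ ∃ (v : ZMod k → α) (e : ZMod k → β), Function.Injective v ∧ Function.Injective e ∧
    ∀ t : ZMod k, G.IsLink (e t) (v t) (v (t + 1))

/-- The length of a shortest cycle of `G`; it is `⊤` if `G` is acyclic. -/
def girth {α β : Type*} (G : Graph α β) : ℕ∞ :=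
  ⨅ (k : ℕ) (_ : HasCycleOfLength G k), (k : ℕ∞)

/-! ## Link diagrams -/

/-- The four half-edges at each of `n` crossings. At each crossing they are numbered `0, 1, 2, 3`
counterclockwise, `0` being the half-edge along which the lower strand enters the crossing.
So `0, 2` belong to the lower strand and `1, 3` to the upper strand. -/
abbrev HalfEdge (n : ℕ) : Type := Fin n × Fin 4

/-- The counterclockwise rotation of the half-edges around each crossing. -/
def rotation (n : ℕ) : Equiv.Perm (HalfEdge n) :=
  Equiv.prodCongr (Equiv.refl (Fin n)) (finRotate 4)

/-- An oriented link diagram with `n` crossings, up to isotopy of the diagram, given by the plane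
`4`-valent graph formed by its crossings (a rotation system: the cyclic order of the half-edges at
each crossing, and the way in which half-edges are joined to form edges), by the crossing
information, and by the number of components without crossings.

The position of the connected pieces of the diagram relative to each other is not recorded. -/
structure LinkDiagram where
  /-- the number of crossings -/
  n : ℕ
  /-- the number of simple closed curves of the diagram which pass through no crossing -/
  freeCircles : ℕ
  /-- the other half of the edge that contains a given half-edge -/
  glue : Equiv.Perm (HalfEdge n)
  glue_glue : ∀ h, glue (glue h) = h
  /-- the crossings at which the upper strand runs from `3` to `1`, the positive ones;
  at the others, the negative ones, it runs from `1` to `3` -/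
  positive : Fin n → Bool
  /-- The orientations of the two halves of an edge fit together: exactly one of them
  points out of its crossing. -/
  glue_oriented : ∀ h : HalfEdge n,
    (((glue h).2 = 2 ∨ (glue h).2 = (if positive (glue h).1 then 1 else 3)) ↔
      ¬ (h.2 = 2 ∨ h.2 = (if positive h.1 then 1 else 3)))
  /-- Planarity: every connected component of the rotation system has genus `0`. Indeed, with
  `V = n` vertices, `E = 2 n` edges, `F` faces (the orbits of `rotation * glue`) and `C` connected
  components, `V - E + F` is the sum of the Euler characteristics of `C` closed connected
  oriented surfaces, so that it equals `2 C` if and only if all of these are spheres. -/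
  planar : Nat.card (Quotient (Equiv.Perm.SameCycle.setoid (rotation n * glue))) =
    n + 2 * Nat.card (MulAction.orbitRel.Quotient
      (Subgroup.closure {rotation n, glue} : Subgroup (Equiv.Perm (HalfEdge n))) (HalfEdge n))

namespace LinkDiagram

variable (D : LinkDiagram)

/-- `c₊(D)`, the number of positive crossings. -/
def cPos : ℕ := (Finset.univ.filter fun c => D.positive c = true).card

/-- `c₋(D)`, the number of negative crossings. -/
def cNeg : ℕ := (Finset.univ.filter fun c => D.positive c = false).card

/-! ## Kauffman states and state graphs

A vertex `I` of the cube `{0,1}ⁿ` is represented by the set of crossings at which it is `1`; its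
height is the cardinality of this set. In the Kauffman state `D(I)` the crossings in `I` have a
`B`-resolution and all others have an `A`-resolution. -/

/-- The half-edge which the resolution of `D` at its crossing connects to a given half-edge. The
`A`-resolution (which joins the two regions swept out by the upper strand when it rotates
counterclockwise) connects `0` with `1` and `2` with `3`; the `B`-resolution connects `0` with `3`
and `1` with `2`. -/
def resolve (I : Finset (Fin D.n)) (h : HalfEdge D.n) : HalfEdge D.n :=
  (h.1, if h.1 ∈ I then (![3, 2, 1, 0] : Fin 4 → Fin 4) h.2
    else (![1, 0, 3, 2] : Fin 4 → Fin 4) h.2)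

/-- The components of the Kauffman state `D(I)`: those which pass through the half-edges, and those
which are free circles of `D`. -/
abbrev Circle (I : Finset (Fin D.n)) : Type :=
  Quot (fun h h' : HalfEdge D.n => h' = D.glue h ∨ h' = D.resolve I h) ⊕ Fin D.freeCircles

/-- The component of `D(I)` through a given half-edge. -/
def circleOf (I : Finset (Fin D.n)) (h : HalfEdge D.n) : D.Circle I :=
  Sum.inl (Quot.mk _ h)

/-- One end of the trace of the crossing `c` in `D(I)`, on the arc through the half-edge `0`. This
arc is `{0, 1}` for an `A`-resolution and `{0, 3}` for a `B`-resolution. -/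
def traceStart (I : Finset (Fin D.n)) (c : Fin D.n) : D.Circle I := D.circleOf I (c, 0)

/-- The other end of the trace of the crossing `c` in `D(I)`, on the arc through the half-edge `2`.
This arc is `{2, 3}` for an `A`-resolution and `{1, 2}` for a `B`-resolution. -/
def traceEnd (I : Finset (Fin D.n)) (c : Fin D.n) : D.Circle I := D.circleOf I (c, 2)

/-- The state graph of the Kauffman state `D(I)`: the vertices are the components of `D(I)`, the
edges are the traces of the crossings. -/
def stateGraph (I : Finset (Fin D.n)) : Graph (D.Circle I) (Fin D.n) where
  vertexSet := Set.univ
  edgeSet := Set.univ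
  IsLink c x y := (x = D.traceStart I c ∧ y = D.traceEnd I c) ∨
    (x = D.traceEnd I c ∧ y = D.traceStart I c)
  isLink_symm := fun _ _ => ⟨fun _ _ h => h.elim (fun h => Or.inr ⟨h.2, h.1⟩)
    (fun h => Or.inl ⟨h.2, h.1⟩)⟩
  eq_or_eq_of_isLink_of_isLink := by
    rintro c x y v w (⟨rfl, rfl⟩ | ⟨rfl, rfl⟩) (⟨rfl, rfl⟩ | ⟨rfl, rfl⟩) <;> simp
  edge_mem_iff_exists_isLink := fun c =>
    ⟨fun _ => ⟨D.traceStart I c, D.traceEnd I c, Or.inl ⟨rfl, rfl⟩⟩, fun _ => Set.mem_univ c⟩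
  left_mem_of_isLink := fun _ _ _ _ => Set.mem_univ _

/-- The all-`A` state graph `G_A(D)`. -/
def allAStateGraph : Graph (D.Circle ∅) (Fin D.n) := D.stateGraph ∅

/-! ## The odd Khovanov complex -/

variable (R : Type*) [CommRing R]

/-- `V(D(I))`, the free `R`-module on the components of `D(I)`. -/
abbrev V (I : Finset (Fin D.n)) : Type _ := D.Circle I →₀ R

/-- The generator of `V(D(I))` given by a component of `D(I)`. -/
def X (I : Finset (Fin D.n)) (x : D.Circle I) : D.V R I := Finsupp.single x 1

/-- The correspondence between the components of `D(I)` and of `D(J)`, where `J` arises from `I`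
by changing the resolution at one crossing: a component is sent to the component of `D(J)` through a
half-edge that lies on it. Only if a component is being split does this depend on the choice of the
half-edge; it is then sent to one of the two resulting components. -/
def eta (I J : Finset (Fin D.n)) : D.Circle I → D.Circle J
  | Sum.inl x => D.circleOf J (Quot.out x)
  | Sum.inr k => Sum.inr k

/-- The map `Λ*(V(D(I))) → Λ*(V(D(J)))` of exterior algebras induced by `eta`. -/
def etaMap (I J : Finset (Fin D.n)) :
    ExteriorAlgebra R (D.V R I) →ₗ[R] ExteriorAlgebra R (D.V R J) :=
  (ExteriorAlgebra.map (Finsupp.lmapDomain R R (D.eta I J))).toLinearMap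

/-- The difference `X_{i₁} - X_{i₂}` in `Λ¹(V(D(J)))`, where the trace of the crossing `c` points
from the component `i₁` of `D(J)` to the component `i₂`.

The orientations of the traces in the all-`A` state are given by `o`: the trace of `c` points from
the arc `{0, 1}` to the arc `{2, 3}` if `o c` is true, and the other way if not. If the resolution of
`c` is a `B`-resolution, then rotating this trace clockwise by 90 degrees makes it point from `{0, 3}`
to `{1, 2}` if `o c` is true, and the other way if not. -/
def traceDifference (o : Fin D.n → Bool) (J : Finset (Fin D.n)) (c : Fin D.n) :
    ExteriorAlgebra R (D.V R J) :=
  if o c then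
    ExteriorAlgebra.ι R (D.X R J (D.traceStart J c) - D.X R J (D.traceEnd J c))
  else
    ExteriorAlgebra.ι R (D.X R J (D.traceEnd J c) - D.X R J (D.traceStart J c))

open Classical in
/-- The unsigned edge map `Λ*(V(D(I))) → Λ*(V(D(J)))`, where `J = I ∪ {c}` and `c ∉ I`. If the trace
of `c` in `D(I)` connects two distinct components, these are merged and the map is `m_odd`, which
identifies the corresponding generators. If not, then (since the diagram is planar) the component is
split, and the map is `Δ_odd`, which is `ω ↦ (X_{i₁} - X_{i₂}) ∧ eta(ω)`. -/
def edgeMap (o : Fin D.n → Bool) (I J : Finset (Fin D.n)) (c : Fin D.n) :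
    ExteriorAlgebra R (D.V R I) →ₗ[R] ExteriorAlgebra R (D.V R J) :=
  if D.traceStart I c ≠ D.traceEnd I c then D.etaMap R I J
  else LinearMap.mulLeft R (D.traceDifference R o J c) ∘ₗ D.etaMap R I J

/-- A sign assignment: signs `ε I c` for the edges `I → I ∪ {c}`, `c ∉ I`, of the cube, such that
every square of the cube anti-commutes once each edge map is multiplied by its sign. (The values
`ε I c` with `c ∈ I` play no role.) -/
def IsSignAssignment (o : Fin D.n → Bool) (ε : Finset (Fin D.n) → Fin D.n → ℤˣ) : Prop :=
  ∀ (I : Finset (Fin D.n)) (a b : Fin D.n), a ∉ I → b ∉ I → a ≠ b →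
    ((ε (insert a I) b : ℤ) • D.edgeMap R o (insert a I) (insert b (insert a I)) b) ∘ₗ
        ((ε I a : ℤ) • D.edgeMap R o I (insert a I) a) +
      ((ε (insert b I) a : ℤ) • D.edgeMap R o (insert b I) (insert b (insert a I)) a) ∘ₗ
        ((ε I b : ℤ) • D.edgeMap R o I (insert b I) b) = 0

/-- The underlying module of `CKh_odd(D)`, the direct sum of all `Λ*(V(D(I)))`. -/
abbrev Chain : Type _ := (I : Finset (Fin D.n)) → ExteriorAlgebra R (D.V R I)

/-- The part of bigrading `(i, j)` of the summand of `CKh_odd(D)` belonging to `I`: it is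
`Λʳ(V(D(I)))` where `i = h(I) - c₋` and `j = |D(I)| - 2 r + h(I) + c₊ - 2 c₋`. -/
def piece (I : Finset (Fin D.n)) (i j : ℤ) : Submodule R (ExteriorAlgebra R (D.V R I)) :=
  ⨆ (r : ℕ) (_ : i = (I.card : ℤ) - D.cNeg ∧
    j = (Nat.card (D.Circle I) : ℤ) - 2 * r + I.card + D.cPos - 2 * D.cNeg),
    (⋀[R]^r (D.V R I))

/-- `CKh_odd^{i,j}(D)`. -/
def chainPart (i j : ℤ) : Submodule R (D.Chain R) :=
  Submodule.pi Set.univ fun I => D.piece R I i j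

/-- The differential of `CKh_odd(D)`: the component at `J` of the image of a chain is the sum of
its signed images under the edges `J \ {c} → J`, `c ∈ J`, of the cube. -/
def differential (o : Fin D.n → Bool) (ε : Finset (Fin D.n) → Fin D.n → ℤˣ) :
    D.Chain R →ₗ[R] D.Chain R :=
  LinearMap.pi fun J => ∑ c ∈ J,
    ((ε (J.erase c) c : ℤ) • D.edgeMap R o (J.erase c) J c) ∘ₗ LinearMap.proj (J.erase c)

/-- The cycles of bigrading `(i, j)`. -/
def cycles (o : Fin D.n → Bool) (ε : Finset (Fin D.n) → Fin D.n → ℤˣ) (i j : ℤ) :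
    Submodule R (D.Chain R) :=
  LinearMap.ker (D.differential R o ε) ⊓ D.chainPart R i j

/-- The boundaries of bigrading `(i, j)`; the differential has bidegree `(1, 0)`. -/
def boundaries (o : Fin D.n → Bool) (ε : Finset (Fin D.n) → Fin D.n → ℤˣ) (i j : ℤ) :
    Submodule R (D.Chain R) :=
  (D.chainPart R (i - 1) j).map (D.differential R o ε)

/-- The odd Khovanov homology `Kh_odd^{i,j}(D; R)`, computed with the orientations `o` of the traces
and the sign assignment `ε`. -/
abbrev OddKhovanovHomology (o : Fin D.n → Bool) (ε : Finset (Fin D.n) → Fin D.n → ℤˣ)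
    (i j : ℤ) : Type _ :=
  D.cycles R o ε i j ⧸ (D.boundaries R o ε i j).submoduleOf (D.cycles R o ε i j)

end LinkDiagram

end OddKh

end

noncomputable section

namespace OddKh

/-! ## Checkerboard colorings of planar diagrams -/

/-! Put `k = i + c₋(D)`, the height in the cube. The homology at height `k` involves only the
heights `k - 1`, `k`, `k + 1`, and `k + 1 ≤ g`. Fewer than `g` crossings form a forest in the state
graph, so passing from the all-`A` state to `D(I)` with `|I| < g` only merges circles. The circles
of `D(I)` are then the vertices of the contraction of the graph along `I`, and the edge maps are
induced by the projections between contractions.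

A set `J` of `g` crossings may be a cycle. Then every edge of the cube into `J` is a split, given by
the wedge product with `X_a - X_b`. The circles `a`, `b` do not depend on the edge, being the only
two distinct circles of `D(J)` with the same image in the contraction. So, up to sign, all edge maps
into `J` are contraction maps followed by one and the same injection (`exists_comparison`). At
height `k + 1` an injection suffices, since it leaves the kernel at height `k` unchanged
(`nonempty_cubeHomology_equiv`). Thus the homology is that of a model built from the graph and a
system of signs (`exists_model`).

The unsigned squares of the model commute, so the signs coming from `D` and from `D'` both
anti-commute around squares. Their quotient is a multiplicative cocycle on a truncated cube, hence a
coboundary (`exists_coboundary`), and rescaling by it makes the two models isomorphic.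

Planarity serves to show that a trace from a circle to itself yields a genuine split
(`traceStart_insert_ne`). It provides a checkerboard coloring (`exists_coloring`), which directs all
circles coherently. -/

theorem rotation_apply {n : ℕ} (c : Fin n) (x : Fin 4) : rotation n (c, x) = (c, x + 1) := by
  simp [rotation, Equiv.prodCongr_apply]

/-- The functions on `α` which are constant on the classes of a setoid. -/
def constOn {α : Type*} (s : Setoid α) : Submodule (ZMod 2) (α → ZMod 2) :=
  LinearMap.range (LinearMap.funLeft (ZMod 2) (ZMod 2) (Quotient.mk s))

theorem mem_constOn {α : Type*} {s : Setoid α} {f : α → ZMod 2} :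
    f ∈ constOn s ↔ ∀ a b, s a b → f a = f b := by
  constructor
  · rintro ⟨g, rfl⟩ a b h
    exact congrArg g (Quotient.sound h)
  · intro h
    exact ⟨Quotient.lift f h, rfl⟩

theorem finrank_constOn {α : Type*} [Finite α] (s : Setoid α) :
    Module.finrank (ZMod 2) (constOn s) = Nat.card (Quotient s) := by
  classical
  have := Fintype.ofFinite (Quotient s)
  rw [constOn, LinearMap.finrank_range_of_inj
    (LinearMap.funLeft_injective_of_surjective _ _ _ Quotient.mk_surjective),
    Module.finrank_fintype_fun_eq_card, Nat.card_eq_fintype_card]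

namespace LinkDiagram

variable (D : LinkDiagram)

/-- Being in the same connected component of the diagram. -/
def componentSetoid : Setoid (HalfEdge D.n) :=
  MulAction.orbitRel (Subgroup.closure {rotation D.n, D.glue} : Subgroup (Equiv.Perm (HalfEdge D.n)))
    (HalfEdge D.n)

theorem mem_constOn_component {f : HalfEdge D.n → ZMod 2} (hr : ∀ h, f (rotation D.n h) = f h)
    (hg : ∀ h, f (D.glue h) = f h) : f ∈ constOn D.componentSetoid := by
  rw [mem_constOn]
  rintro a b ⟨⟨g, hgm⟩, rfl⟩
  change f (g b) = f b
  revert b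
  induction hgm using Subgroup.closure_induction with
  | mem x hx =>
    rcases hx with rfl | rfl
    · exact hr
    · exact hg
  | one => simp
  | mul x y _ _ hx hy => intro b; rw [Equiv.Perm.mul_apply, hx, hy]
  | inv x _ hx => intro b; simpa using (hx (x⁻¹ b)).symm

/-- The functions on half-edges which only depend on the edge. -/
def edgeFunctions : Submodule (ZMod 2) (HalfEdge D.n → ZMod 2) where
  carrier := {g | ∀ h, g (D.glue h) = g h}
  add_mem' := fun ha hb h => by simp [ha h, hb h]
  zero_mem' := fun _ => rfl
  smul_mem' := fun r a ha h => by simp [ha h]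

/-- Every edge has exactly one half pointing out of its crossing, and two half-edges point out of
each crossing. -/
theorem finrank_edgeFunctions_le : Module.finrank (ZMod 2) D.edgeFunctions ≤ 2 * D.n := by
  let out : Fin D.n × Bool → HalfEdge D.n := fun p =>
    (p.1, if p.2 then 2 else if D.positive p.1 then 1 else 3)
  let L : D.edgeFunctions →ₗ[ZMod 2] (Fin D.n × Bool → ZMod 2) :=
    LinearMap.funLeft (ZMod 2) (ZMod 2) out ∘ₗ D.edgeFunctions.subtype
  have hL : Function.Injective L := by
    rw [← LinearMap.ker_eq_bot, LinearMap.ker_eq_bot']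
    rintro ⟨g, hg⟩ h0
    have key : ∀ h : HalfEdge D.n,
        (h.2 = 2 ∨ h.2 = (if D.positive h.1 then 1 else 3)) → g h = 0 := by
      rintro ⟨c, x⟩ (hx | hx)
      · have := congrFun h0 (c, true)
        simp only at hx
        subst hx
        simpa [L, out, LinearMap.funLeft_apply] using this
      · have := congrFun h0 (c, false)
        simp only at hx
        rw [hx]
        simpa [L, out, LinearMap.funLeft_apply] using this
    ext h
    change g h = 0
    by_cases hh : (h.2 = 2 ∨ h.2 = (if D.positive h.1 then 1 else 3))
    · exact key h hh
    · rw [← hg h]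
      exact key _ ((D.glue_oriented h).2 hh)
  have := LinearMap.finrank_le_finrank_of_injective hL
  simpa [Module.finrank_fintype_fun_eq_card, mul_comm] using this

/-- The sums of an edge function over the half-edges at each crossing. -/
def crossingSum : D.edgeFunctions →ₗ[ZMod 2] (Fin D.n → ZMod 2) where
  toFun g c := ∑ x : Fin 4, (g : HalfEdge D.n → ZMod 2) (c, x)
  map_add' a b := by ext c; simp [Finset.sum_add_distrib]
  map_smul' r a := by ext c; simp [Finset.mul_sum]

/-- `crossingSum` is the cellular boundary map from edges to vertices modulo 2. Its cokernel is dual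
to the functions on crossings which agree at the two ends of each edge; these are constant on
connected components. The bound follows by rank-nullity. -/
theorem finrank_ker_crossingSum_le : Module.finrank (ZMod 2) (LinearMap.ker D.crossingSum) ≤
    D.n + Nat.card (Quotient D.componentSetoid) := by
  classical
  have hdual : Module.finrank (ZMod 2) (LinearMap.ker D.crossingSum.dualMap) ≤
      Nat.card (Quotient D.componentSetoid) := by
    let P : Module.Dual (ZMod 2) (Fin D.n → ZMod 2) →ₗ[ZMod 2] (HalfEdge D.n → ZMod 2) :=
      { toFun := fun l h => l (Pi.single h.1 1)
        map_add' := fun _ _ => rfl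
        map_smul' := fun _ _ => rfl }
    have hP : ∀ l ∈ LinearMap.ker D.crossingSum.dualMap, P l ∈ constOn D.componentSetoid := by
      intro l hl
      refine D.mem_constOn_component (fun h => rfl) fun h => ?_
      -- The indicator function of the edge containing `h`; its boundary is the sum of the two end
      -- crossings.
      let g : HalfEdge D.n → ZMod 2 := Pi.single h 1 + Pi.single (D.glue h) 1
      have hg : g ∈ D.edgeFunctions := by
        intro k
        have e1 : D.glue k = h ↔ k = D.glue h :=
          ⟨fun e => by rw [← e, D.glue_glue], fun e => by rw [e, D.glue_glue]⟩
        have e2 : D.glue k = D.glue h ↔ k = h := D.glue.injective.eq_iff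
        simp only [g, Pi.add_apply, Pi.single_apply, e1, e2]
        exact add_comm _ _
      have hs : D.crossingSum ⟨g, hg⟩ = Pi.single h.1 1 + Pi.single (D.glue h).1 1 := by
        have hsingle : ∀ (k : HalfEdge D.n) (c : Fin D.n),
            ∑ x : Fin 4, (Pi.single k (1 : ZMod 2) : HalfEdge D.n → ZMod 2) (c, x) =
              (Pi.single k.1 (1 : ZMod 2) : Fin D.n → ZMod 2) c := by
          rintro ⟨k1, k2⟩ c
          simp only [Pi.single_apply, Prod.mk.injEq]
          by_cases hc : c = k1 <;> simp [hc]
        ext c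
        change ∑ x : Fin 4, g (c, x) = _
        simp only [g, Pi.add_apply, Finset.sum_add_distrib, hsingle]
      have h0 : l (D.crossingSum ⟨g, hg⟩) = 0 := by
        have := LinearMap.congr_fun (LinearMap.mem_ker.1 hl) ⟨g, hg⟩
        simpa using this
      rw [hs, map_add] at h0
      have := CharTwo.add_eq_zero.1 h0
      exact this.symm
    let Q : LinearMap.ker D.crossingSum.dualMap →ₗ[ZMod 2] constOn D.componentSetoid :=
      P.restrict hP
    have hQ : Function.Injective Q := by
      rw [← LinearMap.ker_eq_bot, LinearMap.ker_eq_bot']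
      rintro ⟨l, hl⟩ h0
      have h1 : P l = 0 := congrArg Subtype.val h0
      ext c
      exact congrFun h1 (c, 0)
    rw [← finrank_constOn]
    exact LinearMap.finrank_le_finrank_of_injective hQ
  have h1 := D.crossingSum.finrank_range_add_finrank_ker
  have h2 := D.crossingSum.dualMap.finrank_range_add_finrank_ker
  rw [LinearMap.finrank_range_dualMap_eq_finrank_range, Subspace.dual_finrank_eq,
    Module.finrank_fintype_fun_eq_card, Fintype.card_fin] at h2
  have h3 := D.finrank_edgeFunctions_le
  omega

/-- Since the diagram is planar, the regions at its crossings have a checkerboard coloring. Here a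
half-edge stands for the region on its counterclockwise side. -/
theorem exists_coloring : ∃ col : HalfEdge D.n → ZMod 2,
    (∀ h, col (D.glue h) = col h + 1) ∧ ∀ h, col (rotation D.n h) = col h + 1 := by
  classical
  let s := Equiv.Perm.SameCycle.setoid (rotation D.n * D.glue)
  have hface : ∀ f ∈ constOn s, ∀ h, f (rotation D.n h) = f (D.glue h) := by
    intro f hf h
    have := mem_constOn.1 hf (D.glue h) (rotation D.n h)
      ⟨1, by simp [D.glue_glue]⟩
    exact this.symm
  -- On functions of the faces this is the cellular boundary map to edges: an edge receives the sum
  -- of the values on its two sides.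
  let T0 : (HalfEdge D.n → ZMod 2) →ₗ[ZMod 2] (HalfEdge D.n → ZMod 2) :=
    LinearMap.id + LinearMap.funLeft (ZMod 2) (ZMod 2) D.glue
  have hT0 : ∀ f h, T0 f h = f h + f (D.glue h) := fun f h => rfl
  have hmem : ∀ f ∈ constOn s, T0 f ∈ D.edgeFunctions := by
    intro f _ h
    rw [hT0, hT0, D.glue_glue, add_comm]
  let T : constOn s →ₗ[ZMod 2] D.edgeFunctions := T0.restrict hmem
  have hle : LinearMap.range T ≤ LinearMap.ker D.crossingSum := by
    rintro _ ⟨⟨f, hf⟩, rfl⟩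
    rw [LinearMap.mem_ker]
    ext c
    change ∑ x : Fin 4, T0 f (c, x) = 0
    simp only [hT0, ← hface f hf, rotation_apply, Fin.sum_univ_four]
    have e : (3 : Fin 4) + 1 = 0 := rfl
    have e2 : (2 : Fin 4) + 1 = 3 := rfl
    have e3 : (1 : Fin 4) + 1 = 2 := rfl
    rw [e, e2, e3, zero_add]
    generalize f (c, 0) = p
    generalize f (c, 1) = q
    generalize f (c, 2) = r
    generalize f (c, 3) = t
    revert p q r t
    decide
  have hker : Module.finrank (ZMod 2) (LinearMap.ker T) ≤
      Nat.card (Quotient D.componentSetoid) := by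
    rw [← finrank_constOn, ← Submodule.finrank_map_subtype_eq]
    refine Submodule.finrank_mono ?_
    rintro _ ⟨⟨f, hf⟩, h0, rfl⟩
    have h1 : ∀ h, f h + f (D.glue h) = 0 := fun h =>
      congrFun (congrArg Subtype.val (LinearMap.mem_ker.1 h0)) h
    have h2 : ∀ h, f (D.glue h) = f h := fun h => (CharTwo.add_eq_zero.1 (h1 h)).symm
    exact D.mem_constOn_component (fun h => (hface f hf h).trans (h2 h)) h2
  have hdim : Module.finrank (ZMod 2) (constOn s) =
      D.n + 2 * Nat.card (Quotient D.componentSetoid) := by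
    rw [finrank_constOn]
    exact D.planar
  have h1 := T.finrank_range_add_finrank_ker
  have h2 := D.finrank_ker_crossingSum_le
  -- Euler characteristic count with `C` components: the rank of `T` is at least `(n + 2 C) - C`,
  -- while the cycles have dimension at most `n + C`. So every cycle modulo 2 is a boundary. The sum
  -- of all edges is a cycle, the diagram being 4-valent, and a face function bounding it is a
  -- coloring.
  have heq := Submodule.eq_of_le_of_finrank_le hle (by omega)
  have hone : (⟨fun _ => 1, fun _ => rfl⟩ : D.edgeFunctions) ∈ LinearMap.ker D.crossingSum := by
    rw [LinearMap.mem_ker]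
    ext c
    change ∑ x : Fin 4, (1 : ZMod 2) = 0
    decide
  rw [← heq] at hone
  obtain ⟨⟨f, hf⟩, hfe⟩ := hone
  have h3 : ∀ h, f h + f (D.glue h) = 1 := fun h => congrFun (congrArg Subtype.val hfe) h
  have h4 : ∀ h, f (D.glue h) = f h + 1 := by
    intro h
    have := h3 h
    generalize f h = p at *
    generalize f (D.glue h) = q at *
    revert p q
    decide
  exact ⟨f, h4, fun h => by rw [hface f hf, h4]⟩

end LinkDiagram

end OddKh

end

noncomputable section

namespace OddKh

namespace LinkDiagram

variable {D : LinkDiagram}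

/-! ## The circles of neighbouring Kauffman states -/

theorem glue_ne (h : HalfEdge D.n) : D.glue h ≠ h := by
  intro e
  have := D.glue_oriented h
  rw [e] at this
  tauto

theorem resolve_fst (I : Finset (Fin D.n)) (h : HalfEdge D.n) : (D.resolve I h).1 = h.1 := rfl

theorem resolve_resolve (I : Finset (Fin D.n)) (h : HalfEdge D.n) :
    D.resolve I (D.resolve I h) = h := by
  obtain ⟨c, x⟩ := h
  by_cases hc : c ∈ I <;> simp only [resolve, hc, if_true, if_false] <;> fin_cases x <;> rfl

theorem resolve_ne (I : Finset (Fin D.n)) (h : HalfEdge D.n) : D.resolve I h ≠ h := by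
  obtain ⟨c, x⟩ := h
  by_cases hc : c ∈ I <;> simp only [resolve, hc, if_true, if_false] <;> fin_cases x <;> simp

theorem resolve_insert_of_ne {I : Finset (Fin D.n)} {c : Fin D.n} {h : HalfEdge D.n}
    (hc : h.1 ≠ c) : D.resolve (insert c I) h = D.resolve I h := by
  simp [resolve, hc]

theorem circleOf_glue (I : Finset (Fin D.n)) (h : HalfEdge D.n) :
    D.circleOf I (D.glue h) = D.circleOf I h := by
  refine congrArg Sum.inl (Eq.symm (Quot.sound ?_))
  exact Or.inl rfl

theorem circleOf_resolve (I : Finset (Fin D.n)) (h : HalfEdge D.n) :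
    D.circleOf I (D.resolve I h) = D.circleOf I h := by
  refine congrArg Sum.inl (Eq.symm (Quot.sound ?_))
  exact Or.inr rfl

theorem circleOf_zero_one {I : Finset (Fin D.n)} {c : Fin D.n} (hc : c ∉ I) :
    D.circleOf I (c, 1) = D.circleOf I (c, 0) := by
  simpa [resolve, hc] using circleOf_resolve I (c, 0)

theorem circleOf_two_three {I : Finset (Fin D.n)} {c : Fin D.n} (hc : c ∉ I) :
    D.circleOf I (c, 3) = D.circleOf I (c, 2) := by
  simpa [resolve, hc] using circleOf_resolve I (c, 2)

theorem circleOf_zero_three {I : Finset (Fin D.n)} {c : Fin D.n} (hc : c ∈ I) :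
    D.circleOf I (c, 3) = D.circleOf I (c, 0) := by
  simpa [resolve, hc] using circleOf_resolve I (c, 0)

theorem circleOf_two_one {I : Finset (Fin D.n)} {c : Fin D.n} (hc : c ∈ I) :
    D.circleOf I (c, 1) = D.circleOf I (c, 2) := by
  simpa [resolve, hc] using circleOf_resolve I (c, 2)

/-- A function on half-edges which respects gluing and resolving descends to circles. -/
theorem eq_of_circleOf_eq {I : Finset (Fin D.n)} {β : Type*} (F : HalfEdge D.n → β)
    (hg : ∀ h, F (D.glue h) = F h) (hr : ∀ h, F (D.resolve I h) = F h) {h h' : HalfEdge D.n}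
    (e : D.circleOf I h = D.circleOf I h') : F h = F h' := by
  have e' := Sum.inl_injective e
  refine congrArg (Quot.lift F ?_) e'
  rintro a b (rfl | rfl)
  · exact (hg a).symm
  · exact (hr a).symm

theorem even_card_of_involution {α : Type*} (s : Finset α) (f : α → α)
    (hf : ∀ a ∈ s, f a ∈ s) (hff : ∀ a, f (f a) = a) (hne : ∀ a, f a ≠ a) : Even s.card := by
  have h : ∑ _a ∈ s, (1 : ZMod 2) = 0 :=
    Finset.sum_involution (fun a _ => f a) (fun _ _ => by decide) (fun a _ _ => hne a) hf
      (fun a _ => hff a)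
  rw [Finset.sum_const, nsmul_one] at h
  exact (ZMod.natCast_eq_zero_iff_even).1 h

/-- Changing the resolution at a crossing whose trace connects two circles merges these. -/
theorem circleOf_insert_eq {I : Finset (Fin D.n)} {c : Fin D.n} (hc : c ∉ I)
    (hne : D.traceStart I c ≠ D.traceEnd I c) {h h' : HalfEdge D.n}
    (e : D.circleOf I h = D.circleOf I h') :
    D.circleOf (insert c I) h = D.circleOf (insert c I) h' := by
  classical
  -- The classes of `r` are the pieces of the state left when the crossing `c` is cut out; they are
  -- common to `I` and `insert c I`.
  let r : HalfEdge D.n → HalfEdge D.n → Prop :=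
    fun h h' => h' = D.glue h ∨ (h.1 ≠ c ∧ h' = D.resolve I h)
  let mk : HalfEdge D.n → Quot r := Quot.mk r
  have hmkg : ∀ h, mk (D.glue h) = mk h := fun h =>
    (Quot.sound (show r h (D.glue h) from Or.inl rfl)).symm
  have hmkr : ∀ h : HalfEdge D.n, h.1 ≠ c → mk (D.resolve I h) = mk h :=
    fun h hh => (Quot.sound (show r h (D.resolve I h) from Or.inr ⟨hh, rfl⟩)).symm
  have hI : ∀ {a b}, mk a = mk b → D.circleOf I a = D.circleOf I b := by
    intro a b hab
    refine congrArg (Quot.lift (D.circleOf I) ?_) hab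
    rintro a _ (rfl | ⟨_, rfl⟩)
    · exact (circleOf_glue I a).symm
    · exact (circleOf_resolve I a).symm
  have hJ : ∀ {a b}, mk a = mk b → D.circleOf (insert c I) a = D.circleOf (insert c I) b := by
    intro a b hab
    refine congrArg (Quot.lift (D.circleOf (insert c I)) ?_) hab
    rintro a _ (rfl | ⟨ha, rfl⟩)
    · exact (circleOf_glue _ a).symm
    · rw [← resolve_insert_of_ne ha]
      exact (circleOf_resolve _ a).symm
  let K : Finset (HalfEdge D.n) := Finset.univ.filter fun h => mk h = mk (c, 0)
  have hK : Even K.card := even_card_of_involution K D.glue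
    (fun a ha => by simpa [K, hmkg] using ha) D.glue_glue glue_ne
  have hK' : Even (K.filter fun h => h.1 ≠ c).card := by
    refine even_card_of_involution _ (D.resolve I) (fun a ha => ?_) (resolve_resolve I)
      (resolve_ne I)
    rw [Finset.mem_filter] at ha ⊢
    refine ⟨?_, by simpa [resolve_fst] using ha.2⟩
    have := ha.1
    simp only [K, Finset.mem_filter, Finset.mem_univ, true_and] at this ⊢
    rw [hmkr a ha.2, this]
  have hK'' : Even (K.filter fun h => h.1 = c).card := by
    have := Finset.card_filter_add_card_filter_not (s := K) (fun h => h.1 = c)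
    rw [← this] at hK
    exact (Nat.even_add.1 hK).2 hK'
  -- The piece through `(c, 0)` has an even number of ends at `c`. The ends `2` and `3` lie on the
  -- other circle, so its second end is `1`.
  have h01 : mk (c, 1) = mk (c, 0) := by
    by_contra h1
    have h2 : mk (c, 2) ≠ mk (c, 0) := fun e2 => hne (hI e2).symm
    have h3 : mk (c, 3) ≠ mk (c, 0) := fun e3 => hne
      (((circleOf_two_three hc).symm.trans (hI e3)).symm)
    have : K.filter (fun h => h.1 = c) = {(c, 0)} := by
      ext ⟨c', x⟩
      simp only [K, Finset.mem_filter, Finset.mem_univ, true_and, Finset.mem_singleton,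
        Prod.mk.injEq]
      constructor
      · rintro ⟨hx, rfl⟩
        refine ⟨rfl, ?_⟩
        fin_cases x
        · rfl
        · exact absurd hx h1
        · exact absurd hx h2
        · exact absurd hx h3
      · rintro ⟨rfl, rfl⟩
        exact ⟨rfl, rfl⟩
    rw [this] at hK''
    simp at hK''
  have e01 := hJ h01
  have e03 := circleOf_zero_three (Finset.mem_insert_self c I)
  have e21 := circleOf_two_one (Finset.mem_insert_self c I)
  refine eq_of_circleOf_eq (D.circleOf (insert c I)) (circleOf_glue _) (fun h => ?_) e
  by_cases hh : h.1 = c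
  · obtain ⟨c', x⟩ := h
    simp only at hh
    subst hh
    simp only [resolve, hc, if_false]
    fin_cases x
    · exact e01
    · exact e01.symm
    · exact e03.trans (e01.symm.trans e21)
    · exact (e03.trans (e01.symm.trans e21)).symm
  · rw [← resolve_insert_of_ne (I := I) hh]
    exact circleOf_resolve _ h

/-- If `b` is in the forward orbit of `a` under `σ`, then multiplying `σ` by the transposition of `a`
and `b` cuts this orbit. -/
theorem iterate_ne_of_swap {α : Type*} [DecidableEq α] (p : α → Prop) (σ τ : α → α) {a b : α}
    (ha : p a) (hp : ∀ x, p x → p (σ x)) (hτ : ∀ x, p x → τ x = Equiv.swap a b (σ x)) (hab : a ≠ b)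
    (h : ∃ k, σ^[k] a = b) (m : ℕ) : τ^[m] a ≠ b := by
  classical
  have hk := Nat.find_spec h
  have hmin : ∀ i, i < Nat.find h → σ^[i] a ≠ b := fun i hi => Nat.find_min h hi
  revert hk hmin
  generalize Nat.find h = k
  intro hk hmin
  have hpi : ∀ i, p (σ^[i] a) := by
    intro i
    induction i with
    | zero => exact ha
    | succ i ih => rw [Function.iterate_succ_apply']; exact hp _ ih
  have hk0 : 0 < k := by
    rcases Nat.eq_zero_or_pos k with rfl | h0
    · exact absurd hk hab
    · exact h0
  -- With `k` the first time at which `σ` reaches `b`, the orbit under `τ` stays in `a, σ a, …,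
  -- σ^(k-1) a`: instead of stepping to `b` it returns to `a`.
  have key : ∀ m, ∃ i < k, τ^[m] a = σ^[i] a := by
    intro m
    induction m with
    | zero => exact ⟨0, hk0, rfl⟩
    | succ m ih =>
      obtain ⟨i, hi, e⟩ := ih
      rw [Function.iterate_succ_apply', e, hτ _ (hpi i), ← Function.iterate_succ_apply' σ]
      rcases Nat.lt_or_ge (i + 1) k with h1 | h1
      · refine ⟨i + 1, h1, ?_⟩
        refine Equiv.swap_apply_of_ne_of_ne (fun h2 => ?_) (hmin _ h1)
        refine hmin (k - (i + 1)) (by omega) ?_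
        have : σ^[k - (i + 1)] (σ^[i + 1] a) = b := by
          rw [← Function.iterate_add_apply, Nat.sub_add_cancel h1.le, hk]
        rwa [h2] at this
      · obtain rfl : i + 1 = k := by omega
        exact ⟨0, hk0, by rw [hk, Equiv.swap_apply_right]; rfl⟩
  obtain ⟨i, hi, e⟩ := key m
  rw [e]
  exact hmin i hi

/-- With respect to a checkerboard coloring, two half-edges of the same color which are on the same
circle are in the same orbit of going along this circle. -/
theorem exists_iterate_of_circleOf_eq {col : HalfEdge D.n → ZMod 2}
    (hg : ∀ h, col (D.glue h) = col h + 1) (I : Finset (Fin D.n))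
    (hr : ∀ h, col (D.resolve I h) = col h + 1) {h h' : HalfEdge D.n} (hc : col h = col h')
    (e : D.circleOf I h = D.circleOf I h') :
    ∃ k, (fun x => D.resolve I (D.glue x))^[k] h = h' := by
  classical
  let R : Equiv.Perm (HalfEdge D.n) :=
    ⟨D.resolve I, D.resolve I, resolve_resolve I, resolve_resolve I⟩
  let s : Equiv.Perm (HalfEdge D.n) := R * D.glue
  -- Each arc of a resolution has one end of either color; `F` takes the orbit of the end colored
  -- like `h`, so it is constant along circles.
  let F : HalfEdge D.n → Quotient (Equiv.Perm.SameCycle.setoid s) := fun x =>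
    if col x = col h then Quotient.mk _ x else Quotient.mk _ (D.resolve I x)
  have two : ∀ u v : ZMod 2, u + 1 = v ↔ u ≠ v := by decide
  have hs : ∀ x, (Quotient.mk (Equiv.Perm.SameCycle.setoid s) (D.resolve I (D.glue x))) =
      Quotient.mk _ x := fun x => (Quotient.sound (⟨1, rfl⟩ : s.SameCycle x _)).symm
  have hF : F h = F h' := by
    refine eq_of_circleOf_eq F (fun x => ?_) (fun x => ?_) e
    · simp only [F, hg, two]
      by_cases hx : col x = col h
      · simp only [hx, ne_eq, not_true_eq_false, if_false, if_true, hs]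
      · simp only [hx, ne_eq, not_false_eq_true, if_false, if_true]
        rw [← hs (D.glue x), D.glue_glue]
    · simp only [F, hr, two]
      by_cases hx : col x = col h
      · simp only [hx, ne_eq, not_true_eq_false, if_false, if_true, resolve_resolve]
      · simp only [hx, ne_eq, not_false_eq_true, if_false, if_true]
  simp only [F, hc, if_true] at hF
  have hsc : s.SameCycle h h' := Quotient.exact hF
  obtain ⟨k, _, hk⟩ := hsc.exists_pow_eq'
  refine ⟨k, ?_⟩
  rw [← Equiv.Perm.iterate_eq_pow] at hk
  exact hk

/-- Changing the resolution at a crossing whose trace connects a circle to itself splits this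
circle, since the diagram is planar. -/
theorem traceStart_insert_ne {I : Finset (Fin D.n)} {c : Fin D.n} (hc : c ∉ I)
    (he : D.traceStart I c = D.traceEnd I c) :
    D.traceStart (insert c I) c ≠ D.traceEnd (insert c I) c := by
  classical
  obtain ⟨col, hg, hrot⟩ := D.exists_coloring
  have h1 : ∀ c, col (c, 1) = col (c, 0) + 1 := fun c => by
    rw [← hrot, rotation_apply]; rfl
  have h2 : ∀ c, col (c, 2) = col (c, 0) := fun c => by
    have : col (c, 2) = col (c, 1) + 1 := by rw [← hrot, rotation_apply]; rfl
    rw [this, h1, add_assoc]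
    exact add_zero _
  have h3 : ∀ c, col (c, 3) = col (c, 0) + 1 := fun c => by
    rw [← h2, ← hrot, rotation_apply]; rfl
  have two : ∀ u : ZMod 2, u + 1 + 1 = u := by decide
  have hr : ∀ (J : Finset (Fin D.n)) h, col (D.resolve J h) = col h + 1 := by
    rintro J ⟨c', x⟩
    by_cases hc' : c' ∈ J <;> simp only [resolve, hc', if_true, if_false] <;> fin_cases x <;>
      simp [h1, h2, h3, two]
  intro he'
  obtain ⟨k, hk⟩ := exists_iterate_of_circleOf_eq hg (insert c I) (hr _) (h2 c).symm he'
  -- Going along circles preserves the color. On the color of `(c, 0)` and `(c, 2)`, changing the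
  -- resolution at `c` composes this motion with the transposition of these two half-edges, which
  -- cuts their common orbit.
  refine iterate_ne_of_swap (fun x => col x = col (c, 0)) (fun x => D.resolve I (D.glue x))
    (fun x => D.resolve (insert c I) (D.glue x)) (a := (c, 0)) (b := (c, 2)) rfl ?_ ?_ (by simp)
    (exists_iterate_of_circleOf_eq hg I (hr _) (h2 c).symm he) k hk
  · intro x hx
    rw [hr, hg, two, hx]
  · intro x hx
    have hx' : col (D.glue x) = col (c, 0) + 1 := by rw [hg, hx]
    generalize D.glue x = y at hx'
    by_cases hy : y.1 = c
    · obtain ⟨c', z⟩ := y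
      simp only at hy
      subst hy
      have ne : ∀ u : ZMod 2, u ≠ u + 1 := by decide
      simp only [resolve, hc, if_false, Finset.mem_insert_self, if_true]
      fin_cases z
      · exact absurd hx' (ne _)
      · exact (Equiv.swap_apply_left _ _).symm
      · exact absurd ((h2 _).symm.trans hx') (ne _)
      · exact (Equiv.swap_apply_right _ _).symm
    · rw [resolve_insert_of_ne hy, Equiv.swap_apply_of_ne_of_ne] <;>
      · intro h
        exact hy (congrArg Prod.fst h)

end LinkDiagram

end OddKh

end

noncomputable section

namespace OddKh

/-! ## Contractions of multigraphs -/

/-- The vertices of the graph which arises from `G` by contracting the edges in `I`. -/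
def Contr {α β : Type*} (G : Graph α β) (I : Finset β) : Type _ :=
  Quot (fun x y : α => ∃ c ∈ I, G.IsLink c x y)

namespace Contr

variable {α β : Type*} {G : Graph α β}

/-- The vertex of the contraction given by a vertex of `G`. -/
def mk (I : Finset β) (x : α) : Contr G I := Quot.mk _ x

theorem mk_surjective (I : Finset β) : Function.Surjective (mk (G := G) I) := Quot.mk_surjective

theorem mk_eq_of_isLink {I : Finset β} {c : β} {x y : α} (hc : c ∈ I) (h : G.IsLink c x y) :
    mk (G := G) I x = mk I y :=
  Quot.sound ⟨c, hc, h⟩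

/-- A function on vertices which respects the edges in `I` descends to the contraction. -/
def lift {γ : Type*} {I : Finset β} (F : α → γ)
    (hF : ∀ c x y, c ∈ I → G.IsLink c x y → F x = F y) : Contr G I → γ :=
  Quot.lift F fun _ _ ⟨c, hc, h⟩ => hF c _ _ hc h

theorem mk_mono {I J : Finset β} (hIJ : I ⊆ J) {x y : α} (h : mk (G := G) I x = mk I y) :
    mk (G := G) J x = mk J y :=
  congrArg (lift (mk (G := G) J) fun _ _ _ hc hl => mk_eq_of_isLink (hIJ hc) hl) h

/-- The projection between contractions. (If `I` is not contained in `J`, then it depends on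
choices and is meaningless.) -/
def proj (I J : Finset β) (z : Contr G I) : Contr G J := mk J (Quot.out z)

theorem proj_mk {I J : Finset β} (hIJ : I ⊆ J) (x : α) : proj I J (mk (G := G) I x) = mk J x :=
  mk_mono hIJ (Quot.out_eq (mk (G := G) I x))

/-- Redirecting the class of `b` to that of `a` gives a function which respects all edges in `insert
c I`, so no other identifications arise. -/
theorem mk_insert_eq [DecidableEq β] {I : Finset β} {c : β} {a b x y : α} (hc : G.IsLink c a b)
    (h : mk (G := G) (insert c I) x = mk (insert c I) y) :
    mk (G := G) I x = mk I y ∨ (mk (G := G) I x = mk I a ∧ mk (G := G) I y = mk I b) ∨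
      (mk (G := G) I x = mk I b ∧ mk (G := G) I y = mk I a) := by
  classical
  let F : α → Contr G I := fun x => if mk (G := G) I x = mk I b then mk I a else mk I x
  have hFa : F a = mk I a := by simp only [F]; split_ifs <;> rfl
  have hFb : F b = mk I a := by simp only [F, if_true]
  have hF : F x = F y := by
    refine congrArg (lift F ?_) h
    intro d u v hd hl
    rcases Finset.mem_insert.1 hd with rfl | hd
    · rcases hc.eq_and_eq_or_eq_and_eq hl with ⟨rfl, rfl⟩ | ⟨rfl, rfl⟩
      · rw [hFa, hFb]
      · rw [hFa, hFb]
    · simp only [F, mk_eq_of_isLink hd hl]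
  simp only [F] at hF
  split_ifs at hF with h1 h2 h2
  · exact Or.inl (h1.trans h2.symm)
  · exact Or.inr (Or.inr ⟨h1, hF.symm⟩)
  · exact Or.inr (Or.inl ⟨hF, h2⟩)
  · exact Or.inl hF

/-- The exchange property of the cycle matroid: if `c'` makes `c` redundant over `I`, then `c` makes
`c'` redundant. -/
theorem exchange [DecidableEq β] {I : Finset β} {c c' : β} {a b a' b' : α} (hc : G.IsLink c a b)
    (hc' : G.IsLink c' a' b') (hne : mk (G := G) I a ≠ mk I b)
    (h : mk (G := G) (insert c' I) a = mk (insert c' I) b) :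
    mk (G := G) (insert c I) a' = mk (insert c I) b' := by
  have hI : I ⊆ insert c I := Finset.subset_insert c I
  have hab := mk_eq_of_isLink (Finset.mem_insert_self c I) hc
  rcases mk_insert_eq hc' h with h | ⟨h1, h2⟩ | ⟨h1, h2⟩
  · exact absurd h hne
  · rw [← mk_mono hI h1, ← mk_mono hI h2, hab]
  · rw [← mk_mono hI h1, ← mk_mono hI h2, hab]

/-- If an edge connects vertices which become equal after contracting a set of other edges, then
it closes a cycle. -/
theorem exists_cycle {I : Finset β} {c : β} {x y : α} (hcI : c ∉ I) (hc : G.IsLink c x y)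
    (h : mk (G := G) I x = mk I y) : ∃ m ≤ I.card + 1, HasCycleOfLength G m := by
  classical
  -- Loops and multiplicities are dropped to obtain a path from `y` to `x` without repeated
  -- vertices; the edge `c` then closes it up. If `x = y`, the path is trivial and the cycle is the
  -- loop `c`.
  let S : SimpleGraph α := SimpleGraph.fromRel fun x y => ∃ d ∈ I, G.IsLink d x y
  have hS : ∀ {u v}, S.Adj u v → ∃ d ∈ I, G.IsLink d u v := by
    intro u v huv
    rcases (SimpleGraph.fromRel_adj _ _ _).1 huv with ⟨_, hd | ⟨d, hd, hl⟩⟩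
    · exact hd
    · exact ⟨d, hd, hl.symm⟩
  have hreach : S.Reachable y x := by
    have : S.connectedComponentMk y = S.connectedComponentMk x := by
      refine congrArg (lift S.connectedComponentMk ?_) h.symm
      intro d u v hd hl
      by_cases huv : u = v
      · rw [huv]
      · exact SimpleGraph.ConnectedComponent.sound
          (SimpleGraph.Adj.reachable ((SimpleGraph.fromRel_adj _ _ _).2 ⟨huv, Or.inl ⟨d, hd, hl⟩⟩))
    exact SimpleGraph.ConnectedComponent.exact this
  obtain ⟨p, hp⟩ := hreach.exists_isPath
  have hinj := hp.getVert_injOn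
  have hedge : ∀ i, i < p.length → ∃ d ∈ I, G.IsLink d (p.getVert i) (p.getVert (i + 1)) :=
    fun i hi => hS (p.adj_getVert_succ hi)
  have : Nonempty β := ⟨c⟩
  choose! e he hel using hedge
  have hinj' : ∀ i j, i ≤ p.length → j ≤ p.length → p.getVert i = p.getVert j → i = j :=
    fun i j hi hj hij => hinj hi hj hij
  let v : ZMod (p.length + 1) → α := fun z => p.getVert z.val
  let E : ZMod (p.length + 1) → β := fun z => if z.val < p.length then e z.val else c
  have hval : ∀ z : ZMod (p.length + 1), z.val ≤ p.length := fun z => Nat.le_of_lt_succ z.val_lt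
  have hE : Function.Injective E := by
    intro z w hzw
    apply ZMod.val_injective
    simp only [E] at hzw
    have hz := hval z
    have hw := hval w
    split_ifs at hzw with h1 h2 h2
    · have l1 := hel _ h1
      have l2 := hel _ h2
      rw [hzw] at l1
      rcases l1.eq_and_eq_or_eq_and_eq l2 with ⟨e1, _⟩ | ⟨e1, e2⟩
      · exact hinj' _ _ hz hw e1
      · have := hinj' _ _ (by omega) (by omega) e1
        have := hinj' _ _ (by omega) (by omega) e2
        omega
    · exact absurd (hzw ▸ he _ h1) hcI
    · exact absurd (hzw ▸ he _ h2) hcI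
    · omega
  refine ⟨p.length + 1, ?_, Nat.succ_pos _, v, E, ?_, hE, ?_⟩
  · have hsub : Finset.univ.image E ⊆ insert c I := by
      intro d hd
      obtain ⟨z, _, rfl⟩ := Finset.mem_image.1 hd
      simp only [E]
      split_ifs with h1
      · exact Finset.mem_insert_of_mem (he _ h1)
      · exact Finset.mem_insert_self c I
    have := Finset.card_le_card hsub
    rwa [Finset.card_image_of_injective _ hE, Finset.card_univ, ZMod.card,
      Finset.card_insert_of_notMem hcI] at this
  · intro z w hzw
    exact ZMod.val_injective _ (hinj' _ _ (hval z) (hval w) hzw)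
  · intro z
    simp only [v, E]
    split_ifs with h1
    · have h2 : (z + 1).val = z.val + 1 :=
        Fin.val_add_one_of_lt' (n := p.length + 1) (i := z) (Nat.succ_lt_succ h1)
      rw [h2]
      exact hel _ h1
    · have hz : z.val = p.length := by have := hval z; omega
      have h0 : z + 1 = 0 := by
        rw [← ZMod.natCast_zmod_val z, hz]
        exact_mod_cast ZMod.natCast_self (p.length + 1)
      rw [h0, hz, ZMod.val_zero, SimpleGraph.Walk.getVert_length, SimpleGraph.Walk.getVert_zero]
      exact hc

end Contr

end OddKh

end

noncomputable section

namespace OddKh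

/-! ## Exterior algebras -/

section Exterior

variable {R M N : Type*} [CommRing R] [AddCommGroup M] [Module R M] [AddCommGroup N] [Module R N]

open ExteriorAlgebra in
/-- After multiplication by `v`, the map of exterior algebras induced by a linear map only depends on
the linear map up to multiples of `v`. -/
theorem ι_mul_map_eq {v : N} {f g : M →ₗ[R] N} (h : ∀ m, f m - g m ∈ Submodule.span R {v})
    (x : ExteriorAlgebra R M) : ι R v * map f x = ι R v * map g x := by
  induction x using CliffordAlgebra.left_induction with
  | algebraMap r => rw [AlgHom.commutes, AlgHom.commutes]
  | add x y hx hy => rw [map_add, map_add, mul_add, mul_add, hx, hy]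
  | ι_mul x m hx =>
    change ι R v * map f (ι R m * x) = ι R v * map g (ι R m * x)
    obtain ⟨r, hr⟩ := Submodule.mem_span_singleton.1 (h m)
    have hswap : ∀ w : N, ι R v * ι R w = -(ι R w * ι R v) := fun w =>
      eq_neg_of_add_eq_zero_left (ι_add_mul_swap v w)
    have hfm : f m = g m + r • v := by rw [hr]; abel
    have hv : ι R v * ι R (f m) = ι R v * ι R (g m) := by
      rw [hfm, map_add, map_smul, mul_add, mul_smul_comm, ι_sq_zero, smul_zero, add_zero]
    -- Moving `ι R v` past `ι R (g m)` to apply the induction hypothesis, and back, changes the sign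
    -- twice.
    rw [map_mul, map_mul, map_apply_ι, map_apply_ι, ← mul_assoc, hv, hswap, neg_mul, mul_assoc, hx,
      ← mul_assoc, ← neg_mul, ← hswap, mul_assoc]

open ExteriorAlgebra in
theorem ι_mul_map_injective {v : N} {f : M →ₗ[R] N} {g : N →ₗ[R] M} (d : Module.Dual R N)
    (hd : d v = 1) (hgf : g ∘ₗ f = LinearMap.id) (hgv : g v = 0) :
    Function.Injective fun x : ExteriorAlgebra R M => ι R v * map f x := by
  intro x y hxy
  simp only at hxy
  rw [← sub_eq_zero, ← mul_sub, ← map_sub] at hxy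
  rw [← sub_eq_zero]
  generalize x - y = z at hxy
  -- Contraction with `d` shows that an element annihilated by `v` is a multiple of `v`. Applying
  -- `g`, which kills `v` and is a left inverse of `f`, then gives zero.
  have h1 := CliffordAlgebra.contractLeft_ι_mul (d := d) v (map f z)
  have h2 : map f z = ι R v * CliffordAlgebra.contractLeft (Q := 0) d (map f z) := by
    have h3 : CliffordAlgebra.ι (0 : QuadraticForm R N) v * map f z = 0 := hxy
    rw [h3, map_zero, hd, one_smul] at h1
    exact (sub_eq_zero.1 h1.symm)
  have h4 := congrArg (map g) h2
  rw [map_mul, map_apply_ι, hgv, map_zero, zero_mul, ← AlgHom.comp_apply, map_comp_map, hgf,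
    map_id] at h4
  exact h4

open ExteriorAlgebra in
theorem map_exteriorPower_of_surjective {f : M →ₗ[R] N} (hf : Function.Surjective f) (r : ℕ) :
    (⋀[R]^r M).map (map f).toLinearMap = ⋀[R]^r N := by
  change (LinearMap.range (ι R : M →ₗ[R] _) ^ r).map (map f).toLinearMap =
    LinearMap.range (ι R : N →ₗ[R] _) ^ r
  rw [Submodule.map_pow, ι_range_map_map, LinearMap.range_eq_top.2 hf, Submodule.map_top]

/-- The map of exterior algebras of free modules which is induced by a map of bases. -/
def extMap (R : Type*) [CommRing R] {S T : Type*} (f : S → T) :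
    ExteriorAlgebra R (S →₀ R) →ₐ[R] ExteriorAlgebra R (T →₀ R) :=
  ExteriorAlgebra.map (Finsupp.lmapDomain R R f)

variable {S T U : Type*}

theorem extMap_comp (f : S → T) (g : T → U) (x : ExteriorAlgebra R (S →₀ R)) :
    extMap R g (extMap R f x) = extMap R (g ∘ f) x := by
  rw [extMap, extMap, extMap, Finsupp.lmapDomain_comp, ← ExteriorAlgebra.map_comp_map]
  rfl

theorem extMap_id (x : ExteriorAlgebra R (S →₀ R)) : extMap R id x = x := by
  rw [extMap, Finsupp.lmapDomain_id, ExteriorAlgebra.map_id]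
  rfl

theorem extMap_bijective {f : S → T} (hf : Function.Bijective f) :
    Function.Bijective (extMap R f) := by
  let e := Equiv.ofBijective f hf
  have h1 : e.symm ∘ f = id := funext fun s => e.symm_apply_apply s
  have h2 : f ∘ e.symm = id := funext fun s => e.apply_symm_apply s
  refine Function.bijective_iff_has_inverse.2 ⟨extMap R e.symm, fun x => ?_, fun x => ?_⟩
  · rw [extMap_comp, h1, extMap_id]
  · rw [extMap_comp, h2, extMap_id]

theorem map_extMap_exteriorPower {f : S → T} (hf : Function.Surjective f) (r : ℕ) :
    (⋀[R]^r (S →₀ R)).map (extMap R f).toLinearMap = ⋀[R]^r (T →₀ R) :=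
  map_exteriorPower_of_surjective (Finsupp.mapDomain_surjective hf) r

theorem ι_mul_extMap_eq {f g : S → T} {a b : T}
    (h : ∀ s, f s = g s ∨ (f s = a ∧ g s = b) ∨ (f s = b ∧ g s = a))
    (x : ExteriorAlgebra R (S →₀ R)) :
    ExteriorAlgebra.ι R (Finsupp.single a 1 - Finsupp.single b 1) * extMap R f x =
      ExteriorAlgebra.ι R (Finsupp.single a 1 - Finsupp.single b 1) * extMap R g x := by
  refine ι_mul_map_eq (fun m => ?_) x
  induction m using Finsupp.induction_linear with
  | zero => simp
  | add x y hx hy =>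
    rw [map_add, map_add, add_sub_add_comm]
    exact add_mem hx hy
  | single s r =>
    rw [Finsupp.lmapDomain_apply, Finsupp.lmapDomain_apply, Finsupp.mapDomain_single,
      Finsupp.mapDomain_single, Submodule.mem_span_singleton]
    rcases h s with h | ⟨h1, h2⟩ | ⟨h1, h2⟩
    · exact ⟨0, by simp [h]⟩
    · exact ⟨r, by simp [h1, h2, smul_sub]⟩
    · exact ⟨-r, by simp [h1, h2, smul_sub, neg_add_eq_sub]⟩

theorem ι_mul_extMap_injective {f : S → T} {g : T → S} {a b : T} (hab : a ≠ b)
    (hgf : ∀ s, g (f s) = s) (hgab : g a = g b) :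
    Function.Injective fun x : ExteriorAlgebra R (S →₀ R) =>
      ExteriorAlgebra.ι R (Finsupp.single a 1 - Finsupp.single b 1) * extMap R f x := by
  refine ι_mul_map_injective (g := Finsupp.lmapDomain R R g) (Finsupp.lapply a) ?_ ?_ ?_
  · simp [hab.symm]
  · rw [← Finsupp.lmapDomain_comp, show g ∘ f = id from funext hgf, Finsupp.lmapDomain_id]
  · simp [Finsupp.mapDomain_single, hgab, map_sub]

end Exterior

end OddKh

end

noncomputable section

namespace OddKh

/-! ## Comparison of cube complexes -/

section Cube

variable {R : Type*} [CommRing R]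

/-- Two subquotients are isomorphic if an injective linear map matches them. -/
theorem nonempty_subquotient_equiv {X Y : Type*} [AddCommGroup X] [Module R X] [AddCommGroup Y]
    [Module R Y] (f : X →ₗ[R] Y) {P Z B : Submodule R X} {Z' B' : Submodule R Y}
    (hf : Set.InjOn f P) (hZP : Z ≤ P) (hBP : B ≤ P) (hZ : Z.map f = Z') (hB : B.map f = B') :
    Nonempty ((Z ⧸ B.submoduleOf Z) ≃ₗ[R] (Z' ⧸ B'.submoduleOf Z')) := by
  subst hZ hB
  let e0 : Z →ₗ[R] Z.map f := f.submoduleMap Z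
  have he0 : Function.Bijective e0 := by
    refine ⟨fun x y hxy => ?_, f.submoduleMap_surjective Z⟩
    exact Subtype.ext (hf (hZP x.2) (hZP y.2) (congrArg Subtype.val hxy))
  refine ⟨Submodule.Quotient.equiv _ _ (LinearEquiv.ofBijective e0 he0) ?_⟩
  apply le_antisymm
  · rintro _ ⟨x, hx, rfl⟩
    exact ⟨x, hx, rfl⟩
  · rintro ⟨_, z, hz, rfl⟩ ⟨b, hb, hbz⟩
    have : b = z := hf (hBP hb) (hZP hz) hbz
    subst this
    exact ⟨⟨b, hz⟩, hb, rfl⟩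

variable {β β' : Type*} {A : Finset β → Type*} [∀ I, AddCommGroup (A I)]
  [∀ I, Module R (A I)] {B : Finset β' → Type*} [∀ I, AddCommGroup (B I)]
  [∀ I, Module R (B I)]

/-- The map between cubes of modules which is given by maps of their vertices. -/
def cubeMap (pre : Finset β' → Finset β) (Θ : ∀ I, A (pre I) →ₗ[R] B I) :
    (∀ I, A I) →ₗ[R] ∀ I, B I :=
  LinearMap.pi fun I => Θ I ∘ₗ LinearMap.proj (pre I)

theorem cubeMap_pi {pre : Finset β' → Finset β} (hpre : Function.Bijective pre)
    {Θ : ∀ I, A (pre I) →ₗ[R] B I} {P : ∀ I, Submodule R (A I)} {P' : ∀ I, Submodule R (B I)}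
    (h : ∀ I, (P (pre I)).map (Θ I) = P' I) :
    (Submodule.pi Set.univ P).map (cubeMap pre Θ) = Submodule.pi Set.univ P' := by
  apply le_antisymm
  · rintro _ ⟨x, hx, rfl⟩ I _
    rw [SetLike.mem_coe, ← h I]
    exact Submodule.mem_map_of_mem (hx (pre I) trivial)
  · intro y hy
    -- The preimage is chosen for each vertex `I` of the source cube; the transport along `e` avoids
    -- an inverse of `pre`.
    have key : ∀ I, ∃ z : A I, z ∈ P I ∧ ∀ I' (e : pre I' = I), Θ I' (e ▸ z) = y I' := by
      intro I
      obtain ⟨I', rfl⟩ := hpre.2 I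
      have := hy I' trivial
      rw [SetLike.mem_coe, ← h I'] at this
      obtain ⟨z, hz, hzy⟩ := this
      refine ⟨z, hz, fun I'' e => ?_⟩
      obtain rfl := hpre.1 e
      exact hzy
    choose z hz hzy using key
    exact ⟨z, fun I _ => hz I, funext fun I => hzy (pre I) I rfl⟩

variable [DecidableEq β] [DecidableEq β']

/-- The differential of the complex of a cube of modules, whose edge maps (including signs)
are `a I J c`, where `J = I ∪ {c}`. -/
def cubeDifferential (a : ∀ I J : Finset β, β → A I →ₗ[R] A J) :
    (∀ I, A I) →ₗ[R] ∀ I, A I :=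
  LinearMap.pi fun J => ∑ c ∈ J, a (J.erase c) J c ∘ₗ LinearMap.proj (J.erase c)

theorem cubeDifferential_apply (a : ∀ I J : Finset β, β → A I →ₗ[R] A J) (x : ∀ I, A I)
    (J : Finset β) : cubeDifferential a x J = ∑ c ∈ J, a (J.erase c) J c (x (J.erase c)) := by
  simp [cubeDifferential, LinearMap.sum_apply]

/-- The homology of the complex of a cube of modules at the chains in `P`, where the preceding
chains are those in `P₀`. -/
abbrev CubeHomology (a : ∀ I J : Finset β, β → A I →ₗ[R] A J) (P₀ P : ∀ I, Submodule R (A I)) :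
    Type _ :=
  (LinearMap.ker (cubeDifferential a) ⊓ Submodule.pi Set.univ P : Submodule R (∀ I, A I)) ⧸
    ((Submodule.pi Set.univ P₀).map (cubeDifferential a)).submoduleOf
      (LinearMap.ker (cubeDifferential a) ⊓ Submodule.pi Set.univ P)

/-- At heights `k - 1` and `k` the maps `Θ` match the given graded pieces. At height `k + 1` only
injectivity is needed: it detects whether a chain at height `k` is a cycle. -/
theorem nonempty_cubeHomology_equiv {pre : Finset β' → Finset β} {e : β' ≃ β}
    (hpre : ∀ I, pre I = I.map e.toEmbedding)
    {a : ∀ I J : Finset β, β → A I →ₗ[R] A J} {b : ∀ I J : Finset β', β' → B I →ₗ[R] B J}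
    {Θ : ∀ I, A (pre I) →ₗ[R] B I} {k : ℕ}
    {P₀ P : ∀ I, Submodule R (A I)} {P₀' P' : ∀ I, Submodule R (B I)}
    (hP₀ : ∀ I, I.card + 1 ≠ k → P₀ I = ⊥) (hP : ∀ I, I.card ≠ k → P I = ⊥)
    (hΘ₀ : ∀ I, (P₀ (pre I)).map (Θ I) = P₀' I) (hΘ : ∀ I, (P (pre I)).map (Θ I) = P' I)
    (hinj : ∀ I, I.card ≤ k + 1 → Function.Injective (Θ I))
    (hcomm : ∀ (I : Finset β') (c : β'), c ∉ I → I.card ≤ k → ∀ x : A (pre I),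
      b I (insert c I) c (Θ I x) = Θ (insert c I) (a (pre I) (pre (insert c I)) (e c) x)) :
    Nonempty (CubeHomology a P₀ P ≃ₗ[R] CubeHomology b P₀' P') := by
  classical
  have hcard : ∀ I, (pre I).card = I.card := fun I => by rw [hpre, Finset.card_map]
  have hbij : Function.Bijective pre := by
    rw [show pre = fun I => I.map e.toEmbedding from funext hpre]
    refine ⟨Finset.map_injective _, fun I => ⟨I.map e.symm.toEmbedding, ?_⟩⟩
    ext; simp
  -- The chains in degree `m`.
  let supp : ℤ → Submodule R (∀ I, A I) := fun m =>
    { carrier := {x | ∀ I, (I.card : ℤ) ≠ m → x I = 0}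
      add_mem' := fun hx hy I hI => by simp [hx I hI, hy I hI]
      zero_mem' := fun _ _ => rfl
      smul_mem' := fun r x hx I hI => by simp [hx I hI] }
  have hpi : ∀ {P : ∀ I, Submodule R (A I)} {m : ℤ}, (∀ I, (I.card : ℤ) ≠ m → P I = ⊥) →
      Submodule.pi Set.univ P ≤ supp m := by
    intro P m hP x hx I hI
    have := hx I trivial
    rw [SetLike.mem_coe, hP I hI] at this
    exact this
  have hd : ∀ m : ℤ, m ≤ k → ∀ x ∈ supp m,
      cubeDifferential b (cubeMap pre Θ x) = cubeMap pre Θ (cubeDifferential a x) := by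
    intro m hm x hx
    ext J
    have h1 : cubeMap pre Θ (cubeDifferential a x) J = ∑ c ∈ J,
        Θ J (a (pre (J.erase c)) (pre J) (e c) (x (pre (J.erase c)))) := by
      change Θ J (cubeDifferential a x (pre J)) = _
      rw [cubeDifferential_apply, map_sum]
      have hJ : ∀ c, pre (J.erase c) = (pre J).erase (e c) := by
        intro c
        rw [hpre, hpre, Finset.map_erase]
        rfl
      have := Finset.sum_map J e.toEmbedding
        (fun c => Θ J (a ((pre J).erase c) (pre J) c (x ((pre J).erase c))))
      rw [← hpre] at this
      rw [this]
      refine Finset.sum_congr rfl fun c _ => ?_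
      exact congrArg (fun I => Θ J (a I (pre J) (e c) (x I))) (hJ c).symm
    rw [h1, cubeDifferential_apply]
    refine Finset.sum_congr rfl fun c hc => ?_
    change b (J.erase c) J c (Θ (J.erase c) (x (pre (J.erase c)))) = _
    by_cases hcd : ((J.erase c).card : ℤ) = m
    · have := hcomm (J.erase c) c (Finset.notMem_erase c J) (by omega) (x (pre (J.erase c)))
      rw [Finset.insert_erase hc] at this
      exact this
    · rw [hx (pre (J.erase c)) (by rwa [hcard])]
      simp only [map_zero]
  have hdsupp : ∀ (m : ℤ), ∀ x ∈ supp m, cubeDifferential a x ∈ supp (m + 1) := by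
    intro m x hx I hI
    rw [cubeDifferential_apply]
    refine Finset.sum_eq_zero fun c hc => ?_
    rw [hx, map_zero]
    rw [Finset.card_erase_of_mem hc]
    have := Finset.card_pos.2 ⟨c, hc⟩
    omega
  have hinj0 : ∀ m : ℤ, m ≤ k + 1 → Set.InjOn (cubeMap pre Θ) (supp m) := by
    intro m hm x hx y hy hxy
    ext I
    obtain ⟨I', rfl⟩ := hbij.2 I
    by_cases hI : ((pre I').card : ℤ) = m
    · exact hinj I' (by rw [← hcard]; omega) (congrFun hxy I')
    · rw [hx _ hI, hy _ hI]
  have hs : Submodule.pi Set.univ P ≤ supp k := hpi fun I hI => hP I (by exact_mod_cast hI)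
  have hs₀ : Submodule.pi Set.univ P₀ ≤ supp (k - 1) := hpi fun I hI => hP₀ I (by omega)
  refine nonempty_subquotient_equiv (cubeMap pre Θ) (hinj0 k (by omega)) (inf_le_right.trans hs)
    ?_ ?_ ?_
  · rintro _ ⟨x, hx, rfl⟩
    simpa using hdsupp _ x (hs₀ hx)
  · apply le_antisymm
    · rintro _ ⟨x, ⟨hx0, hx⟩, rfl⟩
      refine ⟨?_, ?_⟩
      · rw [SetLike.mem_coe, LinearMap.mem_ker, hd k le_rfl x (hs hx), LinearMap.mem_ker.1 hx0,
          map_zero]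
      · rw [← cubeMap_pi hbij hΘ]
        exact Submodule.mem_map_of_mem hx
    · rintro y ⟨hy0, hy⟩
      rw [← cubeMap_pi hbij hΘ] at hy
      obtain ⟨x, hx, rfl⟩ := hy
      refine ⟨x, ⟨?_, hx⟩, rfl⟩
      rw [SetLike.mem_coe, LinearMap.mem_ker, hd k le_rfl x (hs hx)] at hy0
      exact hinj0 (k + 1) le_rfl (hdsupp k x (hs hx)) (zero_mem _) (hy0.trans (map_zero _).symm)
  · rw [← cubeMap_pi hbij hΘ₀]
    ext y
    constructor
    · rintro ⟨_, ⟨x, hx, rfl⟩, rfl⟩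
      exact ⟨_, ⟨x, hx, rfl⟩, hd _ (by omega) x (hs₀ hx)⟩
    · rintro ⟨_, ⟨x, hx, rfl⟩, rfl⟩
      exact ⟨_, ⟨x, hx, rfl⟩, (hd _ (by omega) x (hs₀ hx)).symm⟩

end Cube

end OddKh

end

noncomputable section

namespace OddKh

namespace LinkDiagram

variable {D : LinkDiagram}

/-! ## Circles of Kauffman states as vertices of contractions of the all-`A` state graph -/

theorem isLink_allAStateGraph (c : Fin D.n) :
    D.allAStateGraph.IsLink c (D.circleOf ∅ (c, 0)) (D.circleOf ∅ (c, 2)) := Or.inl ⟨rfl, rfl⟩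

/-- A `B`-resolution at `c` connects half-edges on the two ends of the trace of `c` in the all-`A`
state, and these ends are identified by contracting `c`. -/
theorem mk_circleOf_resolve (J : Finset (Fin D.n)) (h : HalfEdge D.n) :
    Contr.mk (G := D.allAStateGraph) J (D.circleOf ∅ (D.resolve J h)) =
      Contr.mk J (D.circleOf ∅ h) := by
  obtain ⟨c, x⟩ := h
  by_cases hc : c ∈ J
  · have h0 := Contr.mk_eq_of_isLink (G := D.allAStateGraph) hc (isLink_allAStateGraph c)
    have h1 := circleOf_zero_one (Finset.notMem_empty c)
    have h2 := circleOf_two_three (Finset.notMem_empty c)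
    simp only [resolve, hc, if_true]
    fin_cases x
    · exact (congrArg _ h2).trans h0.symm
    · exact h0.symm.trans (congrArg _ h1.symm)
    · exact (congrArg _ h1).trans h0
    · exact h0.trans (congrArg _ h2.symm)
  · have : D.resolve J (c, x) = D.resolve ∅ (c, x) := by simp [resolve, hc]
    rw [this, circleOf_resolve]

variable (D) in
/-- The circles of `D(J)` are mapped to the vertices of the contraction of the all-`A` state graph
along the edges in `J`. -/
def contract (J : Finset (Fin D.n)) : D.Circle J → Contr D.allAStateGraph J :=
  Sum.elim (Quot.lift (fun h => Contr.mk J (D.circleOf ∅ h)) (by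
    rintro h _ (rfl | rfl)
    · rw [circleOf_glue]
    · rw [mk_circleOf_resolve])) fun k => Contr.mk J (Sum.inr k)

theorem contract_circleOf (J : Finset (Fin D.n)) (h : HalfEdge D.n) :
    D.contract J (D.circleOf J h) = Contr.mk J (D.circleOf ∅ h) := rfl

theorem circle_cases {J : Finset (Fin D.n)} (x : D.Circle J) :
    (∃ h, x = D.circleOf J h) ∨ ∃ k, x = Sum.inr k := by
  rcases x with x | k
  · obtain ⟨h, rfl⟩ := Quot.exists_rep x
    exact Or.inl ⟨h, rfl⟩
  · exact Or.inr ⟨k, rfl⟩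

theorem contract_surjective (J : Finset (Fin D.n)) : Function.Surjective (D.contract J) := by
  intro z
  obtain ⟨x, rfl⟩ := Contr.mk_surjective J z
  rcases circle_cases x with ⟨h, rfl⟩ | ⟨k, rfl⟩
  · exact ⟨D.circleOf J h, rfl⟩
  · exact ⟨Sum.inr k, rfl⟩

theorem contract_eta {I J : Finset (Fin D.n)} (hIJ : I ⊆ J) (x : D.Circle I) :
    D.contract J (D.eta I J x) = Contr.proj I J (D.contract I x) := by
  rcases x with x | k
  · have hx : (Sum.inl x : D.Circle I) = D.circleOf I (Quot.out x) :=
      congrArg Sum.inl (Quot.out_eq x).symm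
    conv_rhs => rw [hx]
    rw [contract_circleOf, Contr.proj_mk hIJ]
    rfl
  · exact (Contr.proj_mk hIJ _).symm

variable (D) in
/-- The edges in `J` contain no cycle of the all-`A` state graph. -/
def IsForest (J : Finset (Fin D.n)) : Prop :=
  ∀ I c, c ∉ I → insert c I ⊆ J →
    Contr.mk (G := D.allAStateGraph) I (D.circleOf ∅ (c, 0)) ≠ Contr.mk I (D.circleOf ∅ (c, 2))

theorem IsForest.mono {I J : Finset (Fin D.n)} (hJ : D.IsForest J) (hIJ : I ⊆ J) :
    D.IsForest I := fun K c hc hK => hJ K c hc (hK.trans hIJ)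

theorem IsForest.traceStart_ne {I J : Finset (Fin D.n)} (hJ : D.IsForest J) {c : Fin D.n}
    (hc : c ∉ I) (hIJ : insert c I ⊆ J) : D.traceStart I c ≠ D.traceEnd I c := fun h =>
  hJ I c hc hIJ (congrArg (D.contract I) h)

theorem IsForest.circleOf_eq {J : Finset (Fin D.n)} (hJ : D.IsForest J) {h h' : HalfEdge D.n}
    (e : D.circleOf ∅ h = D.circleOf ∅ h') : D.circleOf J h = D.circleOf J h' := by
  induction J using Finset.induction_on with
  | empty => exact e
  | insert c I hc ih =>
    exact circleOf_insert_eq hc (hJ.traceStart_ne hc subset_rfl)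
      (ih (hJ.mono (Finset.subset_insert c I)))

/-- Along a forest circles only merge, so each circle of the all-`A` state determines a circle of
`D(J)`. This assignment descends to the contraction and inverts `contract`. -/
theorem IsForest.contract_injective {J : Finset (Fin D.n)} (hJ : D.IsForest J) :
    Function.Injective (D.contract J) := by
  let F : D.Circle ∅ → D.Circle J := Sum.elim (Quot.lift (D.circleOf J) (by
    rintro h h' e
    exact hJ.circleOf_eq (congrArg Sum.inl (Quot.sound e)))) Sum.inr
  have hF : ∀ h, F (D.circleOf ∅ h) = D.circleOf J h := fun h => rfl
  have hc : ∀ c ∈ J, D.circleOf J (c, 0) = D.circleOf J (c, 2) := by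
    intro c hc
    rw [← circleOf_zero_three hc]
    exact hJ.circleOf_eq (circleOf_two_three (Finset.notMem_empty c))
  let ρ : Contr D.allAStateGraph J → D.Circle J := Contr.lift F (by
    rintro c _ _ hcJ (⟨rfl, rfl⟩ | ⟨rfl, rfl⟩)
    · exact hc c hcJ
    · exact (hc c hcJ).symm)
  have hρ : ∀ x, ρ (D.contract J x) = x := by
    intro x
    rcases circle_cases x with ⟨h, rfl⟩ | ⟨k, rfl⟩ <;> rfl
  exact Function.LeftInverse.injective hρ

/-- If the trace of `c` in `D(I)` connects a circle to itself, then the contraction only identifies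
the two circles into which it is split. -/
theorem IsForest.contract_insert_eq {I : Finset (Fin D.n)} (hI : D.IsForest I) {c : Fin D.n}
    (hc : c ∉ I)
    (he : Contr.mk (G := D.allAStateGraph) I (D.circleOf ∅ (c, 0)) =
      Contr.mk I (D.circleOf ∅ (c, 2)))
    {x y : D.Circle (insert c I)} (h : D.contract (insert c I) x = D.contract (insert c I) y) :
    x = y ∨ (x = D.traceStart (insert c I) c ∧ y = D.traceEnd (insert c I) c) ∨
      (x = D.traceEnd (insert c I) c ∧ y = D.traceStart (insert c I) c) := by
  classical
  have hmk : ∀ {u v : D.Circle ∅}, Contr.mk (G := D.allAStateGraph) (insert c I) u =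
      Contr.mk (insert c I) v → Contr.mk (G := D.allAStateGraph) I u = Contr.mk I v := by
    intro u v huv
    rcases Contr.mk_insert_eq (isLink_allAStateGraph c) huv with h | ⟨h1, h2⟩ | ⟨h1, h2⟩
    · exact h
    · rw [h1, h2, he]
    · rw [h1, h2, he]
  rcases circle_cases x with ⟨p, rfl⟩ | ⟨p, rfl⟩ <;> rcases circle_cases y with ⟨q, rfl⟩ | ⟨q, rfl⟩
  · have hpq : D.circleOf I p = D.circleOf I q := hI.contract_injective (hmk h)
    -- With the two ends of the trace of `c` identified, the circles of `D(insert c I)` become a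
    -- function on the circles of `D(I)`.
    let F : HalfEdge D.n → D.Circle (insert c I) := fun h =>
      if D.circleOf (insert c I) h = D.traceEnd (insert c I) c then D.traceStart (insert c I) c
      else D.circleOf (insert c I) h
    have hFc : ∀ x, F (c, x) = D.traceStart (insert c I) c := by
      intro x
      have h3 := circleOf_zero_three (Finset.mem_insert_self c I)
      have h1 := circleOf_two_one (Finset.mem_insert_self c I)
      simp only [F]
      split_ifs with hx
      · rfl
      · fin_cases x
        · rfl
        · exact absurd h1 hx
        · exact absurd rfl hx
        · exact h3
    have hF : F p = F q := by
      refine eq_of_circleOf_eq F (fun h => ?_) (fun h => ?_) hpq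
      · simp only [F, circleOf_glue]
      · by_cases hh : h.1 = c
        · obtain ⟨c', x⟩ := h
          simp only at hh
          subst hh
          exact (hFc _).trans (hFc _).symm
        · rw [← resolve_insert_of_ne hh]
          simp only [F, circleOf_resolve]
    simp only [F] at hF
    split_ifs at hF with h1 h2 h2
    · exact Or.inl (h1.trans h2.symm)
    · exact Or.inr (Or.inr ⟨h1, hF.symm⟩)
    · exact Or.inr (Or.inl ⟨hF, h2⟩)
    · exact Or.inl hF
  · have : D.circleOf I p = Sum.inr q := hI.contract_injective (hmk h)
    exact absurd this Sum.inl_ne_inr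
  · have : Sum.inr p = D.circleOf I q := hI.contract_injective (hmk h)
    exact absurd this Sum.inr_ne_inl
  · have : (Sum.inr p : D.Circle I) = Sum.inr q := hI.contract_injective (hmk h)
    exact Or.inl (congrArg Sum.inr (Sum.inr_injective this))

/-- A minimal set of edges which is not a forest is a cycle. -/
theorem mk_erase_eq_of_not_isForest {J : Finset (Fin D.n)}
    (hI : ∀ I ⊂ J, D.IsForest I) (hJ : ¬ D.IsForest J) {c : Fin D.n} (hc : c ∈ J) :
    Contr.mk (G := D.allAStateGraph) (J.erase c) (D.circleOf ∅ (c, 0)) =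
      Contr.mk (J.erase c) (D.circleOf ∅ (c, 2)) := by
  simp only [IsForest, not_forall, not_not] at hJ
  obtain ⟨I, d, hd, hdJ, h⟩ := hJ
  obtain rfl : insert d I = J := by
    by_contra hne
    exact hI _ (hdJ.ssubset_of_ne hne) I d hd subset_rfl h
  by_cases hcd : c = d
  · subst hcd
    rwa [Finset.erase_insert hd]
  · have hcI : c ∈ I := (Finset.mem_insert.1 hc).resolve_left hcd
    have hne : d ∉ I.erase c := fun h => hd (Finset.mem_of_mem_erase h)
    have hJc : (insert d I).erase c = insert d (I.erase c) :=
      Finset.erase_insert_of_ne (Ne.symm hcd)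
    rw [hJc]
    refine Contr.exchange (isLink_allAStateGraph d) (isLink_allAStateGraph c) ?_ ?_
    · refine hI ((insert d I).erase c) (Finset.erase_ssubset hc) _ d hne ?_
      rw [hJc]
    · rwa [Finset.insert_erase hcI]

theorem isForest_of_card_le {k : ℕ} (hk : ∀ m ≤ k, ¬ HasCycleOfLength D.allAStateGraph m)
    {J : Finset (Fin D.n)} (hJ : J.card ≤ k) : D.IsForest J := by
  intro I c hc hIJ h
  obtain ⟨m, hm, hcyc⟩ := Contr.exists_cycle hc (isLink_allAStateGraph c) h
  refine hk m (hm.trans ?_) hcyc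
  rw [← Finset.card_insert_of_notMem hc]
  exact (Finset.card_le_card hIJ).trans hJ

/-! ## The edge maps in low degrees -/

variable (D) in
/-- A choice of a circle of `D(J)` for each vertex of the contraction. -/
def circleSection (J : Finset (Fin D.n)) : Contr D.allAStateGraph J → D.Circle J :=
  Function.surjInv (contract_surjective J)

theorem contract_circleSection (J : Finset (Fin D.n)) (z : Contr D.allAStateGraph J) :
    D.contract J (D.circleSection J z) = z := Function.surjInv_eq _ z

theorem IsForest.circleSection_bijective {J : Finset (Fin D.n)} (hJ : D.IsForest J) :
    Function.Bijective (D.circleSection J) :=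
  ⟨Function.injective_surjInv _, fun x => ⟨D.contract J x,
    hJ.contract_injective (contract_circleSection J _)⟩⟩

section

variable {R : Type*} [CommRing R]

/-- In low degrees the edge maps are, up to signs and injective maps, induced by contractions. -/
theorem exists_comparison (o : Fin D.n → Bool) {k : ℕ}
    (hk : ∀ J : Finset (Fin D.n), J.card ≤ k → D.IsForest J) :
    ∃ (Θ : ∀ J : Finset (Fin D.n), ExteriorAlgebra R (Contr D.allAStateGraph J →₀ R) →ₗ[R]
        ExteriorAlgebra R (D.V R J)) (u : Finset (Fin D.n) → Fin D.n → ℤˣ),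
      (∀ J, J.card ≤ k → Θ J = (extMap R (D.circleSection J)).toLinearMap) ∧
      (∀ J, J.card ≤ k + 1 → Function.Injective (Θ J)) ∧
      ∀ I c, c ∉ I → I.card ≤ k → ∀ y, D.edgeMap R o I (insert c I) c (Θ I y) =
        (u I c : ℤ) • Θ (insert c I) (extMap R (Contr.proj I (insert c I)) y) := by
  classical
  have hΘ : ∀ J : Finset (Fin D.n), ∃ Θ : ExteriorAlgebra R (Contr D.allAStateGraph J →₀ R) →ₗ[R]
      ExteriorAlgebra R (D.V R J),
      (J.card ≤ k → Θ = (extMap R (D.circleSection J)).toLinearMap) ∧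
      (J.card ≤ k + 1 → Function.Injective Θ) ∧
      ∀ I c, c ∉ I → insert c I = J → I.card ≤ k → ∃ u : ℤˣ, ∀ y,
        D.edgeMap R o I J c (extMap R (D.circleSection I) y) =
        (u : ℤ) • Θ (extMap R (Contr.proj I J) y) := by
    intro J
    by_cases hJ : D.IsForest J
    · refine ⟨(extMap R (D.circleSection J)).toLinearMap, fun _ => rfl, fun _ =>
        (extMap_bijective hJ.circleSection_bijective).1, fun I c hc hIJ _ => ⟨1, fun y => ?_⟩⟩
      subst hIJ
      rw [Units.val_one, one_smul, edgeMap, if_pos (hJ.traceStart_ne hc subset_rfl)]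
      change extMap R (D.eta I (insert c I)) (extMap R (D.circleSection I) y) =
        extMap R (D.circleSection (insert c I)) (extMap R (Contr.proj I (insert c I)) y)
      rw [extMap_comp, extMap_comp]
      congr 2
      funext z
      refine hJ.contract_injective ?_
      simp only [Function.comp_apply]
      rw [contract_eta (Finset.subset_insert c I), contract_circleSection, contract_circleSection]
    by_cases hcard : J.card = k + 1
    · obtain ⟨d, hd⟩ : J.Nonempty := Finset.card_pos.1 (by omega)
      let a := D.traceStart J d
      let b := D.traceEnd J d
      have hsub : ∀ I ⊂ J, D.IsForest I := fun I hI => hk I (by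
        have := Finset.card_lt_card hI
        omega)
      -- The circles at the ends of the trace of a crossing of the cycle.
      have hends : ∀ I c, c ∉ I → insert c I = J →
          D.traceStart I c = D.traceEnd I c ∧ D.traceStart J c ≠ D.traceEnd J c ∧
          D.contract J (D.traceStart J c) = D.contract J (D.traceEnd J c) ∧
          ∀ x y, D.contract J x = D.contract J y → x = y ∨
            (x = D.traceStart J c ∧ y = D.traceEnd J c) ∨
            (x = D.traceEnd J c ∧ y = D.traceStart J c) := by
        rintro I c hc rfl
        have hI : D.IsForest I := hsub I (Finset.ssubset_insert hc)
        have he := mk_erase_eq_of_not_isForest hsub hJ (Finset.mem_insert_self c I)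
        rw [Finset.erase_insert hc] at he
        have hst : D.traceStart I c = D.traceEnd I c := hI.contract_injective he
        exact ⟨hst, traceStart_insert_ne hc hst,
          Contr.mk_mono (Finset.subset_insert c I) he,
          fun x y hxy => hI.contract_insert_eq hc he hxy⟩
      obtain ⟨-, hab, hcab, hpair⟩ := hends (J.erase d) d (Finset.notMem_erase d J)
        (Finset.insert_erase hd)
      -- Here `J` is a cycle, by minimality. The crossing `d` merely fixes the order of the circles
      -- `a` and `b`; another crossing of `J` gives the same pair, up to order.
      refine ⟨LinearMap.mulLeft R
        (ExteriorAlgebra.ι R (Finsupp.single a 1 - Finsupp.single b 1)) ∘ₗ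
          (extMap R (D.circleSection J)).toLinearMap, fun h => absurd h (by omega), fun _ =>
        ι_mul_extMap_injective hab (contract_circleSection J) hcab, fun I c hc hIJ hI => ?_⟩
      obtain ⟨hst, hne, hcst, -⟩ := hends I c hc hIJ
      have htd : ∃ u : ℤˣ, D.traceDifference R o J c =
          (u : ℤ) • ExteriorAlgebra.ι R (Finsupp.single a 1 - Finsupp.single b 1) := by
        have hor : (D.traceStart J c = a ∧ D.traceEnd J c = b) ∨
            (D.traceStart J c = b ∧ D.traceEnd J c = a) :=
          (hpair _ _ hcst).resolve_left hne
        have hneg : ∀ x y : D.V R J, ExteriorAlgebra.ι R (y - x) =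
            ((-1 : ℤˣ) : ℤ) • ExteriorAlgebra.ι R (x - y) := fun x y => by
          rw [Units.val_neg, Units.val_one, neg_one_smul, ← map_neg, neg_sub]
        rw [traceDifference, X, X]
        rcases hor with ⟨h1, h2⟩ | ⟨h1, h2⟩ <;> rw [h1, h2] <;> split_ifs
        · exact ⟨1, by simp⟩
        · exact ⟨-1, hneg _ _⟩
        · exact ⟨-1, hneg _ _⟩
        · exact ⟨1, by simp⟩
      obtain ⟨u, hu⟩ := htd
      refine ⟨u, fun y => ?_⟩
      rw [edgeMap, if_neg (not_not.2 hst), hu]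
      change ((u : ℤ) • ExteriorAlgebra.ι R (Finsupp.single a 1 - Finsupp.single b 1)) *
          extMap R (D.eta I J) (extMap R (D.circleSection I) y) =
        (u : ℤ) • (ExteriorAlgebra.ι R (Finsupp.single a 1 - Finsupp.single b 1) *
          extMap R (D.circleSection J) (extMap R (Contr.proj I J) y))
      rw [extMap_comp, extMap_comp, smul_mul_assoc]
      congr 1
      -- Both maps lift the same contraction map, so they differ at most by interchanging `a` and
      -- `b`, which the factor `X_a - X_b` does not see.
      refine ι_mul_extMap_eq (fun z => hpair _ _ ?_) y
      have hIJ' : I ⊆ J := hIJ ▸ Finset.subset_insert c I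
      simp only [Function.comp_apply]
      rw [contract_eta hIJ', contract_circleSection, contract_circleSection]
    · refine ⟨0, fun h => absurd (hk J h) hJ, fun h => ?_, fun I c hc hIJ hI => ?_⟩
      · exact absurd (hk J (by omega)) hJ
      · have := Finset.card_insert_of_notMem hc
        rw [hIJ] at this
        exact absurd (hk J (by omega)) hJ
  choose Θ hΘ1 hΘ2 hΘ3 using hΘ
  have hu : ∀ I c, ∃ u : ℤˣ, c ∉ I → I.card ≤ k → ∀ y, D.edgeMap R o I (insert c I) c (Θ I y) =
        (u : ℤ) • Θ (insert c I) (extMap R (Contr.proj I (insert c I)) y) := by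
    intro I c
    by_cases hc : c ∉ I ∧ I.card ≤ k
    · obtain ⟨u, hu⟩ := hΘ3 (insert c I) I c hc.1 rfl hc.2
      refine ⟨u, fun _ _ y => ?_⟩
      rw [hΘ1 I hc.2]
      exact hu y
    · exact ⟨1, fun h1 h2 => absurd ⟨h1, h2⟩ hc⟩
  choose u hu using hu
  exact ⟨Θ, u, hΘ1, hΘ2, hu⟩

end

end LinkDiagram

end OddKh

end

noncomputable section

namespace OddKh

/-! ## Signs -/

/-- A multiplicative `1`-cocycle on the part of the cube below height `k` is a coboundary. -/
theorem exists_coboundary {β M : Type*} [DecidableEq β] [CommGroup M] (w : Finset β → β → M)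
    (k : ℕ) (hw : ∀ I a b, a ∉ I → b ∉ I → a ≠ b → I.card + 2 ≤ k →
      w I a * w (insert a I) b = w I b * w (insert b I) a) :
    ∃ t : Finset β → M, ∀ I c, c ∉ I → I.card + 1 ≤ k → t (insert c I) = t I * w I c := by
  classical
  induction k with
  | zero => exact ⟨fun _ => 1, fun I c _ h => by omega⟩
  | succ k ih =>
    obtain ⟨t, ht⟩ := ih fun I a b ha hb hab h => hw I a b ha hb hab (by omega)
    -- At the new top height the value is defined through an arbitrary element of `J`; the cocycle
    -- condition shows that every other element gives the same value.
    let t' : Finset β → M := fun J =>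
      if h : J.card = k + 1 then
        let c := (Finset.card_pos.1 (h ▸ Nat.succ_pos k : 0 < J.card)).choose
        t (J.erase c) * w (J.erase c) c
      else t J
    refine ⟨t', fun I c hc hI => ?_⟩
    have hcard := Finset.card_insert_of_notMem hc
    have htI : t' I = t I := dif_neg (by omega)
    rw [htI]
    by_cases hk : I.card + 1 = k + 1
    · have hJ : (insert c I).card = k + 1 := by omega
      have ht' : ∃ d ∈ insert c I,
          t' (insert c I) = t ((insert c I).erase d) * w ((insert c I).erase d) d :=
        ⟨_, (Finset.card_pos.1 (hJ ▸ Nat.succ_pos k : 0 < (insert c I).card)).choose_spec,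
          dif_pos hJ⟩
      obtain ⟨d, hd, hdt⟩ := ht'
      rw [hdt]
      by_cases hdc : d = c
      · rw [hdc, Finset.erase_insert hc]
      · have hdI : d ∈ I := (Finset.mem_insert.1 hd).resolve_left hdc
        have hcK : c ∉ I.erase d := fun h => hc (Finset.mem_of_mem_erase h)
        have hdK := Finset.notMem_erase d I
        have hKc := Finset.card_erase_of_mem hdI
        have hpos := Finset.card_pos.2 ⟨d, hdI⟩
        have h1 := ht (I.erase d) c hcK (by omega)
        have h2 := ht (I.erase d) d hdK (by omega)
        have h3 := hw (I.erase d) c d hcK hdK (Ne.symm hdc) (by omega)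
        rw [Finset.insert_erase hdI] at h2 h3
        rw [Finset.erase_insert_of_ne (Ne.symm hdc), h1, h2, mul_assoc, mul_assoc, h3]
    · have hJ : t' (insert c I) = t (insert c I) := dif_neg (by omega)
      rw [hJ]
      exact ht I c hc (by omega)

/-! ## The model of the complex in low degrees -/

section Model

variable {R : Type*} [CommRing R] {α β : Type*}

/-- The part of bigrading `(m, j)` of the exterior algebra of a contraction of a graph. -/
def modelPiece (R : Type*) [CommRing R] (G : Graph α β) (m j : ℤ) (I : Finset β) :
    Submodule R (ExteriorAlgebra R (Contr G I →₀ R)) :=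
  ⨆ (r : ℕ) (_ : m = (I.card : ℤ) ∧ j = (Nat.card (Contr G I) : ℤ) - 2 * r + I.card),
    (⋀[R]^r (Contr G I →₀ R))

theorem modelPiece_eq_bot {G : Graph α β} {m j : ℤ} {I : Finset β} (h : (I.card : ℤ) ≠ m) :
    modelPiece R G m j I = ⊥ := by
  simp only [modelPiece, iSup_eq_bot]
  intro r hr
  exact absurd hr.1.symm h

/-- The edge maps of the model, with signs `v`. -/
def modelMap (G : Graph α β) (v : Finset β → β → Rˣ) (I J : Finset β) (c : β) :
    ExteriorAlgebra R (Contr G I →₀ R) →ₗ[R] ExteriorAlgebra R (Contr G J →₀ R) :=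
  (v I c : R) • (extMap R (Contr.proj I J)).toLinearMap

variable {α' β' : Type*}

/-- An isomorphism of graphs gives bijections between the vertices of contractions. -/
def Contr.congr {G : Graph α β} {G' : Graph α' β'} (F : α ≃ α') (E : β' ≃ β)
    (hFE : ∀ b x y, G.IsLink (E b) x y ↔ G'.IsLink b (F x) (F y)) (I : Finset β') :
    Contr G (I.map E.toEmbedding) ≃ Contr G' I :=
  Quot.congr F fun x y => by
    constructor
    · rintro ⟨c, hc, hl⟩
      obtain ⟨d, hd, rfl⟩ := Finset.mem_map.1 hc
      exact ⟨d, hd, (hFE d x y).1 hl⟩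
    · rintro ⟨d, hd, hl⟩
      exact ⟨E d, Finset.mem_map_of_mem _ hd, (hFE d x y).2 hl⟩

theorem Contr.congr_proj {G : Graph α β} {G' : Graph α' β'} (F : α ≃ α') (E : β' ≃ β)
    (hFE : ∀ b x y, G.IsLink (E b) x y ↔ G'.IsLink b (F x) (F y)) {I J : Finset β'} (hIJ : I ⊆ J)
    (z : Contr G (I.map E.toEmbedding)) :
    Contr.congr F E hFE J (Contr.proj _ _ z) = Contr.proj I J (Contr.congr F E hFE I z) := by
  obtain ⟨x, rfl⟩ := Contr.mk_surjective _ z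
  rw [Contr.proj_mk (Finset.map_subset_map.2 hIJ)]
  exact (Contr.proj_mk hIJ (F x)).symm

theorem map_modelPiece_congr {G : Graph α β} {G' : Graph α' β'} (F : α ≃ α') (E : β' ≃ β)
    (hFE : ∀ b x y, G.IsLink (E b) x y ↔ G'.IsLink b (F x) (F y)) (m j : ℤ) (I : Finset β') :
    (modelPiece R G m j (I.map E.toEmbedding)).map
      (extMap R (Contr.congr F E hFE I)).toLinearMap = modelPiece R G' m j I := by
  simp only [modelPiece, Submodule.map_iSup,
    map_extMap_exteriorPower (Contr.congr F E hFE I).surjective, Finset.card_map,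
    Nat.card_congr (Contr.congr F E hFE I)]

end Model

/-! ### Identification of the model with the complex of a diagram -/

namespace LinkDiagram

variable {D : LinkDiagram} {R : Type*} [CommRing R]

theorem IsForest.map_modelPiece {J : Finset (Fin D.n)} (hJ : D.IsForest J) {m i j j' : ℤ}
    (hi : i + D.cNeg = m) (hj : j - D.cPos + 2 * D.cNeg = j') :
    (modelPiece R D.allAStateGraph m j' J).map (extMap R (D.circleSection J)).toLinearMap =
      D.piece R J i j := by
  have hcard : Nat.card (Contr D.allAStateGraph J) = Nat.card (D.Circle J) :=
    Nat.card_congr (Equiv.ofBijective _ hJ.circleSection_bijective)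
  simp only [modelPiece, piece, Submodule.map_iSup,
    map_extMap_exteriorPower hJ.circleSection_bijective.2, hcard]
  refine iSup_congr fun r => iSup_congr_Prop ?_ fun _ => rfl
  constructor <;> rintro ⟨h1, h2⟩ <;> constructor <;> linarith

theorem piece_eq_bot {J : Finset (Fin D.n)} {i j : ℤ} (h : (J.card : ℤ) ≠ i + D.cNeg) :
    D.piece R J i j = ⊥ := by
  simp only [piece, iSup_eq_bot]
  intro r hr
  exact absurd (by linarith [hr.1]) h

/-- The comparison of the model with the complex of a diagram in low degrees. -/
theorem exists_model (o : Fin D.n → Bool) (ε : Finset (Fin D.n) → Fin D.n → ℤˣ)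
    (hε : D.IsSignAssignment R o ε) {k : ℕ}
    (hk : ∀ J : Finset (Fin D.n), J.card ≤ k → D.IsForest J) :
    ∃ (Θ : ∀ J : Finset (Fin D.n), ExteriorAlgebra R (Contr D.allAStateGraph J →₀ R) →ₗ[R]
        ExteriorAlgebra R (D.V R J)) (v : Finset (Fin D.n) → Fin D.n → Rˣ),
      (∀ (m i j j' : ℤ), m ≤ k → i + D.cNeg = m → j - D.cPos + 2 * D.cNeg = j' → ∀ J,
        (modelPiece R D.allAStateGraph m j' J).map (Θ J) = D.piece R J i j) ∧
      (∀ J, J.card ≤ k + 1 → Function.Injective (Θ J)) ∧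
      (∀ I c, c ∉ I → I.card ≤ k → ∀ y,
        ((ε I c : ℤ) • D.edgeMap R o I (insert c I) c) (Θ I y) =
          Θ (insert c I) (modelMap D.allAStateGraph v I (insert c I) c y)) ∧
      ∀ I a b, a ∉ I → b ∉ I → a ≠ b → I.card + 2 ≤ k + 1 →
        v I a * v (insert a I) b = -(v I b * v (insert b I) a) := by
  obtain ⟨Θ, u, h1, h2, h3⟩ := exists_comparison (R := R) o hk
  -- The signs are taken in `Rˣ`, since anti-commutation of maps of `R`-modules only determines
  -- their images in `R`.
  let v : Finset (Fin D.n) → Fin D.n → Rˣ := fun I c =>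
    Units.map (Int.castRingHom R).toMonoidHom (ε I c * u I c)
  have hv : ∀ I c, (v I c : R) = ((ε I c : ℤ) : R) * ((u I c : ℤ) : R) := fun I c => by
    simp [v]
  have h4 : ∀ I c, c ∉ I → I.card ≤ k → ∀ y,
      ((ε I c : ℤ) • D.edgeMap R o I (insert c I) c) (Θ I y) =
        Θ (insert c I) (modelMap D.allAStateGraph v I (insert c I) c y) := by
    intro I c hc hI y
    rw [LinearMap.smul_apply, h3 I c hc hI y, modelMap, LinearMap.smul_apply, map_smul, hv,
      mul_smul, Int.cast_smul_eq_zsmul, Int.cast_smul_eq_zsmul]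
    rfl
  refine ⟨Θ, v, ?_, h2, h4, ?_⟩
  · intro m i j j' hm hi hj J
    by_cases hJ : J.card ≤ k
    · rw [h1 J hJ]
      exact (hk J hJ).map_modelPiece hi hj
    · rw [modelPiece_eq_bot (by omega), piece_eq_bot (by omega), Submodule.map_bot]
  · intro I a b ha hb hab hI
    have hba : b ∉ insert a I := by simp [hb, hab.symm]
    have hab' : a ∉ insert b I := by simp [ha, hab]
    have hca := Finset.card_insert_of_notMem ha
    have hcb := Finset.card_insert_of_notMem hb
    have hcab := Finset.card_insert_of_notMem hba
    -- Evaluated at `1`, each path around a square gives the product of its signs, as the unsigned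
    -- model maps preserve `1`. Injectivity of `Θ` at the far corner then turns the anti-commuting
    -- square into a relation between signs.
    have hone : ∀ J L c, modelMap D.allAStateGraph v J L c 1 = algebraMap R _ (v J c : R) := by
      intro J L c
      rw [modelMap, LinearMap.smul_apply, AlgHom.toLinearMap_apply, map_one,
        Algebra.algebraMap_eq_smul_one]
    have hone' : ∀ J L c (r : R), modelMap D.allAStateGraph v J L c (algebraMap R _ r) =
        algebraMap R _ (r * v J c : R) := by
      intro J L c r
      rw [Algebra.algebraMap_eq_smul_one, map_smul, hone, map_mul, Algebra.smul_def]
    have e1 := h4 (insert a I) b hba (by omega) (modelMap D.allAStateGraph v I (insert a I) a 1)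
    have e2 := h4 (insert b I) a hab' (by omega) (modelMap D.allAStateGraph v I (insert b I) b 1)
    rw [Finset.insert_comm] at e2
    rw [← h4 I a ha (by omega), hone, hone'] at e1
    rw [← h4 I b hb (by omega), hone, hone'] at e2
    have h0 := LinearMap.congr_fun (hε I a b ha hb hab) (Θ I 1)
    rw [LinearMap.add_apply, LinearMap.comp_apply, LinearMap.comp_apply, e1, e2, ← map_add,
      ← map_add, LinearMap.zero_apply] at h0
    have h5 := h2 (insert b (insert a I)) (by omega) (h0.trans (map_zero _).symm)
    rw [ExteriorAlgebra.algebraMap_eq_zero_iff] at h5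
    exact Units.ext (eq_neg_of_add_eq_zero_left h5)

theorem nonempty_oddKhovanovHomology_equiv {D' : LinkDiagram}
    (F : D.Circle ∅ ≃ D'.Circle ∅) (E : Fin D'.n ≃ Fin D.n)
    (hFE : ∀ b x y, D.allAStateGraph.IsLink (E b) x y ↔ D'.allAStateGraph.IsLink b (F x) (F y))
    {k : ℕ} (hk : ∀ J : Finset (Fin D.n), J.card ≤ k → D.IsForest J)
    (hk' : ∀ J : Finset (Fin D'.n), J.card ≤ k → D'.IsForest J)
    (o : Fin D.n → Bool) (o' : Fin D'.n → Bool)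
    (ε : Finset (Fin D.n) → Fin D.n → ℤˣ) (ε' : Finset (Fin D'.n) → Fin D'.n → ℤˣ)
    (hε : D.IsSignAssignment R o ε) (hε' : D'.IsSignAssignment R o' ε') {i j p q : ℤ}
    (hi : i + D.cNeg = k) (hp : p + D'.cNeg = k)
    (hq : q - D'.cPos + 2 * D'.cNeg = j - D.cPos + 2 * D.cNeg) :
    Nonempty (D.OddKhovanovHomology R o ε i j ≃ₗ[R] D'.OddKhovanovHomology R o' ε' p q) := by
  obtain ⟨Θ, v, hP, hinj, hcomm, hv⟩ := exists_model o ε hε hk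
  obtain ⟨Θ', v', hP', hinj', hcomm', hv'⟩ := exists_model o' ε' hε' hk'
  have e1 : Nonempty (CubeHomology (modelMap D.allAStateGraph v)
      (modelPiece R D.allAStateGraph (k - 1) (j - D.cPos + 2 * D.cNeg))
      (modelPiece R D.allAStateGraph k (j - D.cPos + 2 * D.cNeg)) ≃ₗ[R]
      D.OddKhovanovHomology R o ε i j) :=
    nonempty_cubeHomology_equiv (pre := id) (e := Equiv.refl _)
      (b := fun I J c => (ε I c : ℤ) • D.edgeMap R o I J c) (Θ := Θ) (k := k)
      (P₀' := fun I => D.piece R I (i - 1) j) (P' := fun I => D.piece R I i j)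
      (fun I => Finset.map_refl.symm)
      (fun I hI => modelPiece_eq_bot (by omega)) (fun I hI => modelPiece_eq_bot (by omega))
      (hP _ _ _ _ (by omega) (by omega) rfl) (hP _ _ _ _ le_rfl hi rfl) hinj hcomm
  -- The minus signs in the relations for `v` and `v'` cancel in the quotient, which is therefore a
  -- cocycle.
  let w : Finset (Fin D'.n) → Fin D'.n → Rˣ := fun I c =>
    v' I c * (v (I.map E.toEmbedding) (E c))⁻¹
  obtain ⟨t, ht⟩ := exists_coboundary w (k + 1) (by
    intro I a b ha hb hab hI
    have h1 := hv' I a b ha hb hab hI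
    have h2 := hv (I.map E.toEmbedding) (E a) (E b) (by simpa using ha) (by simpa using hb)
      (E.injective.ne hab) (by rwa [Finset.card_map])
    simp only [w, Finset.map_insert, Equiv.coe_toEmbedding]
    rw [mul_mul_mul_comm, ← mul_inv, h1, h2, inv_neg, neg_mul_neg, mul_mul_mul_comm, ← mul_inv])
  let T : ∀ I : Finset (Fin D'.n), ExteriorAlgebra R
      (Contr D.allAStateGraph (I.map E.toEmbedding) →₀ R) →ₗ[R] ExteriorAlgebra R (D'.V R I) :=
    fun I => (t I : R) • (Θ' I ∘ₗ (extMap R (Contr.congr F E hFE I)).toLinearMap)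
  have hT : ∀ I x, T I x = (t I : R) • Θ' I (extMap R (Contr.congr F E hFE I) x) :=
    fun _ _ => rfl
  have hTP : ∀ (m i j : ℤ), m ≤ k → i + D'.cNeg = m → ∀ J,
      (modelPiece R D.allAStateGraph m (j - D'.cPos + 2 * D'.cNeg) (J.map E.toEmbedding)).map
        (T J) = D'.piece R J i j := by
    intro m i j hm hi J
    rw [← hP' m i j _ hm hi rfl J, ← map_modelPiece_congr F E hFE, ← Submodule.map_comp]
    apply le_antisymm
    · rintro _ ⟨x, hx, rfl⟩
      exact ⟨(t J : R) • x, Submodule.smul_mem _ _ hx, by rw [map_smul]; rfl⟩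
    · rintro _ ⟨x, hx, rfl⟩
      refine ⟨((t J)⁻¹ : Rˣ) • x, Submodule.smul_mem _ _ hx, ?_⟩
      rw [Units.smul_def, map_smul, hT, smul_smul, Units.inv_mul, one_smul]
      rfl
  have e2 : Nonempty (CubeHomology (modelMap D.allAStateGraph v)
      (modelPiece R D.allAStateGraph (k - 1) (j - D.cPos + 2 * D.cNeg))
      (modelPiece R D.allAStateGraph k (j - D.cPos + 2 * D.cNeg)) ≃ₗ[R]
      D'.OddKhovanovHomology R o' ε' p q) := by
    rw [← hq]
    refine nonempty_cubeHomology_equiv (pre := fun I => I.map E.toEmbedding) (e := E)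
      (b := fun I J c => (ε' I c : ℤ) • D'.edgeMap R o' I J c) (Θ := T) (k := k)
      (P₀' := fun I => D'.piece R I (p - 1) q) (P' := fun I => D'.piece R I p q)
      (fun I => rfl)
      (fun I hI => modelPiece_eq_bot (by omega)) (fun I hI => modelPiece_eq_bot (by omega))
      (hTP _ _ _ (by omega) (by omega)) (hTP _ _ _ le_rfl hp) ?_ ?_
    · intro I hI x y hxy
      rw [hT, hT, ← Units.smul_def, ← Units.smul_def] at hxy
      exact (extMap_bijective (Contr.congr F E hFE I).bijective).1
        (hinj' I hI (smul_left_cancel _ hxy))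
    · intro I c hc hI x
      have hw : (t (insert c I) : R) * v (I.map E.toEmbedding) (E c) = t I * v' I c := by
        rw [← Units.val_mul, ← Units.val_mul, ht I c hc (by omega)]
        simp only [w]
        rw [mul_assoc, inv_mul_cancel_right]
      have hnat : ∀ y, extMap R (Contr.congr F E hFE (insert c I)) (extMap R (Contr.proj _ _) y) =
          extMap R (Contr.proj I (insert c I)) (extMap R (Contr.congr F E hFE I) y) := by
        intro y
        rw [extMap_comp, extMap_comp]
        congr 2
        funext z
        exact Contr.congr_proj F E hFE (Finset.subset_insert c I) z
      rw [hT, hT, map_smul, hcomm' I c hc hI, modelMap, modelMap, LinearMap.smul_apply,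
        LinearMap.smul_apply, map_smul, map_smul, map_smul, smul_smul, smul_smul,
        AlgHom.toLinearMap_apply, AlgHom.toLinearMap_apply, hnat]
      exact congrArg (· • _) hw.symm
  exact ⟨e1.some.symm.trans e2.some⟩

end LinkDiagram

/-! ### Girth and the main theorem -/

theorem le_girth_of_hasCycleOfLength {α β : Type*} {G : Graph α β} {m : ℕ}
    (h : HasCycleOfLength G m) : girth G ≤ m := iInf₂_le m h

theorem GraphIsomorphic.hasCycleOfLength {α β α' β' : Type*} {G : Graph α β} {H : Graph α' β'}
    (h : GraphIsomorphic G H) {m : ℕ} (hm : HasCycleOfLength H m) : HasCycleOfLength G m := by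
  obtain ⟨f, e, hfe⟩ := h
  obtain ⟨h0, v, d, hv, hd, hl⟩ := hm
  let V : ZMod m → H.vertexSet := fun t => ⟨v t, (hl t).left_mem⟩
  let B : ZMod m → H.edgeSet := fun t => ⟨d t, (hl t).edge_mem⟩
  refine ⟨h0, fun t => f.symm (V t), fun t => e.symm (B t), fun s t hst => ?_, fun s t hst => ?_,
    fun t => ?_⟩
  · exact hv (congrArg Subtype.val (f.symm.injective (Subtype.ext hst)))
  · exact hd (congrArg Subtype.val (e.symm.injective (Subtype.ext hst)))
  · rw [hfe, e.apply_symm_apply, f.apply_symm_apply, f.apply_symm_apply]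
    exact hl t

end OddKh

end

theorem theorem6p1 {R : Type*} [CommRing R] (D D' : OddKh.LinkDiagram)
    (hiso : OddKh.GraphIsomorphic D.allAStateGraph D'.allAStateGraph)
    (hgirth : 2 ≤ OddKh.girth D.allAStateGraph)
    (o : Fin D.n → Bool) (o' : Fin D'.n → Bool)
    (ε : Finset (Fin D.n) → Fin D.n → ℤˣ) (ε' : Finset (Fin D'.n) → Fin D'.n → ℤˣ)
    (hε : D.IsSignAssignment R o ε) (hε' : D'.IsSignAssignment R o' ε')
    (i j p q : ℤ)
    (hi : -(D.cNeg : ℤ) ≤ i)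
    (hi' : ∀ g : ℕ, OddKh.girth D.allAStateGraph = (g : ℕ∞) → i ≤ -(D.cNeg : ℤ) + g - 1)
    (hp : p + (D'.cNeg : ℤ) = i + (D.cNeg : ℤ))
    (hq : q - (D'.cPos : ℤ) + 2 * (D'.cNeg : ℤ) = j - (D.cPos : ℤ) + 2 * (D.cNeg : ℤ)) :
    Nonempty (D.OddKhovanovHomology R o ε i j ≃ₗ[R] D'.OddKhovanovHomology R o' ε' p q) := by
  obtain ⟨k, hk⟩ := Int.eq_ofNat_of_zero_le (show 0 ≤ i + D.cNeg by linarith)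
  -- A cycle of length at most `k` would make the girth a finite `g ≤ k`, whereas the bound on `i`
  -- says `k ≤ g - 1`.
  have hcyc : ∀ m ≤ k, ¬ OddKh.HasCycleOfLength D.allAStateGraph m := by
    intro m hm hc
    have h1 := OddKh.le_girth_of_hasCycleOfLength hc
    obtain ⟨g, hg⟩ := ENat.ne_top_iff_exists.1 (ne_top_of_le_ne_top (ENat.natCast_ne_top m) h1)
    have h2 := hi' g hg.symm
    rw [← hg, Nat.cast_le] at h1
    omega
  have hcyc' : ∀ m ≤ k, ¬ OddKh.HasCycleOfLength D'.allAStateGraph m :=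
    fun m hm hc => hcyc m hm (hiso.hasCycleOfLength hc)
  obtain ⟨f, e, hfe⟩ := hiso
  let F : D.Circle ∅ ≃ D'.Circle ∅ :=
    (Equiv.Set.univ _).symm.trans (f.trans (Equiv.Set.univ _))
  let E : Fin D'.n ≃ Fin D.n := (Equiv.Set.univ _).symm.trans (e.symm.trans (Equiv.Set.univ _))
  refine OddKh.LinkDiagram.nonempty_oddKhovanovHomology_equiv F E (fun b x y => ?_)
    (fun J hJ => OddKh.LinkDiagram.isForest_of_card_le hcyc hJ)
    (fun J hJ => OddKh.LinkDiagram.isForest_of_card_le hcyc' hJ)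
    o o' ε ε' hε hε' hk (hp.trans hk) hq
  have := hfe (e.symm ⟨b, Set.mem_univ b⟩) ⟨x, Set.mem_univ x⟩ ⟨y, Set.mem_univ y⟩
  rw [e.apply_symm_apply] at this
  exact this
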